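/- Consider $N\ge 1$ identical agents $\dot x_i(t)=Ax_i(t)+Bu_i(t)$, $y_i(t)=Cx_i(t)$, $x_i(t)\in\mathbb R^n$, $u_i(t)\in\mathbb R^m$, $y_i(t)\in\mathbb R^p$, where agent $i$ receives $\zeta_i(t)=\sum_{j=1}^N a_{ij}\,[\,y_i(t)-y_j(t-\tau_{ij})\,]$ with $a_{ij}\ge 0$, $a_{ii}=0$ and unknown constant communication delays $\tau_{ij}\ge 0$. The weights $a_{ij}$ define a directed graph with an edge from $j$ to $i$ iff $a_{ij}>0$, and its Laplacian $L=[\ell_{ij}]$ has $\ell_{ii}=\sum_k a_{ik}$ and $\ell_{ij}=-a_{ij}$ for $i\ne j$. For $\alpha>\beta>0$ let $\mathbb G^N_{\alpha,\beta}$ be the set of such graphs that are equal to a directed spanning tree with root agent $1$ and whose Laplacian is lower triangular with zero first row and satisfies $\beta\le\ell_{ii}\le\alpha$ for $i=2,\dots,N$. Let $\bar\tau_{i}$ be the sum of the delays along the path from the root to agent $i$ (so $\bar\tau_1=0$), and for arbitrary pairs write $\tau_{ij}:=\bar\tau_i-\bar\tau_j$, which agrees with the communication delay whenever there is an edge from $j$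 to $i$. Delayed state synchronization means $\lim_{t\to\infty}[x_i(t)-x_j(t-\tau_{ij})]=0$ for all $i,j$. A dynamic protocol $\dot\chi_i=A_c\chi_i+B_c\zeta_i$, $u_i=C_c\chi_i+D_c\zeta_i$ solves the problem for $\mathbb G^N_{\alpha,\beta}$ if this holds for every graph in $\mathbb G^N_{\alpha,\beta}$, all delays $\tau_{ij}\ge0$, and all initial data (the initial histories of the $x_i$ and the initial values $\chi_i(0)$). **Theorem.** Let $\alpha>\beta>0$, let $(A,B)$ be stabilizable, $(A,C)$ observable, and let all eigenvalues of $A$ lie in the closed left half plane. Then the delayed state synchronization problem for $\mathbb G^N_{\alpha,\beta}$ is solvable by a dynamic protocol. More precisely, there are matrices $K$ with $A+KC$ Hurwitz stable; for every $\delta>0$ the Riccati equation $$A^{\mathsf T}P_\delta+P_\delta A-P_\delta BB^{\mathsf T}P_\delta+\delta I=0$$ has a unique positive definite solution $P_\delta$; and for every $K$ with $A+KC$ Hurwitz stable there exists $\delta^*>0$ such that for every $\delta\in(0,\delta^*]$ the protocol $$\dot\chi_i=(A+KC)\chi_i-K\zeta_i,\qquad u_i=-\beta^{-1}B^{\mathsf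 T}P_\delta\chi_i$$ solves the problem for $\mathbb G^N_{\alpha,\beta}$. Moreover, with this protocol the synchronized trajectory is that of the root agent: for every graph in $\mathbb G^N_{\alpha,\beta}$, all delays and all initial data, with $$x_s(t)=\begin{pmatrix} I&0\end{pmatrix}e^{\bar At}\begin{pmatrix}x_1(0)\\ \chi_1(0)\end{pmatrix},\qquad \bar A=\begin{pmatrix}A&-\beta^{-1}BB^{\mathsf T}P_\delta\\0&A+KC\end{pmatrix},$$ one has $x_1(t)=x_s(t)$ for $t\ge0$ and $x_i(t+\bar\tau_i)-x_s(t)\to0$ as $t\to\infty$ for every $i$; and if the protocol of the root agent starts at rest, $\chi_1(0)=0$, then $x_s(t)=e^{At}x_1(0)$. -/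

import Mathlib

open Set Filter Topology Matrix

namespace MAS

/-! ### Linear systems -/

/-- Every (complex) eigenvalue of the real matrix `A` lies in the open left half plane. -/
def IsHurwitz {n : ℕ} (A : Matrix (Fin n) (Fin n) ℝ) : Prop :=
  ∀ μ ∈ spectrum ℂ (A.map (algebraMap ℝ ℂ)), μ.re < 0

/-- Every (complex) eigenvalue of the real matrix `A` lies in the closed left half plane. -/
def EigenvaluesInClosedLeftHalfPlane {n : ℕ} (A : Matrix (Fin n) (Fin n) ℝ) : Prop :=
  ∀ μ ∈ spectrum ℂ (A.map (algebraMap ℝ ℂ)), μ.re ≤ 0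

/-- `(A, B)` is stabilizable: some state feedback `u = F x` makes `A + B F` Hurwitz stable. -/
def IsStabilizable {n m : ℕ} (A : Matrix (Fin n) (Fin n) ℝ) (B : Matrix (Fin n) (Fin m) ℝ) :
    Prop :=
  ∃ F : Matrix (Fin m) (Fin n) ℝ, IsHurwitz (A + B * F)

/-- `(A, C)` is observable: the observability matrix with blocks `C, C A, …, C A ^ (n - 1)`
has trivial kernel. -/
def IsObservable {n p : ℕ} (A : Matrix (Fin n) (Fin n) ℝ) (C : Matrix (Fin p) (Fin n) ℝ) :
    Prop :=
  ∀ v : Fin n → ℝ, (∀ k < n, (C * A ^ k) *ᵥ v = 0) → v = 0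

/-- `P` is a positive definite solution of the low-gain algebraic Riccati equation
`Aᵀ P + P A - P B Bᵀ P + δ I = 0`. -/
def IsLowGainRiccatiSolution {n m : ℕ} (A : Matrix (Fin n) (Fin n) ℝ)
    (B : Matrix (Fin n) (Fin m) ℝ) (δ : ℝ) (P : Matrix (Fin n) (Fin n) ℝ) : Prop :=
  P.PosDef ∧ Aᵀ * P + P * A - P * B * Bᵀ * P + δ • (1 : Matrix (Fin n) (Fin n) ℝ) = 0

/-! ### Communication graphs -/

/-- A weighted directed graph on `N` nodes without self loops: `weight i j = a_{ij} ≥ 0`, and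
there is an edge from `j` to `i` exactly when `a_{ij} > 0`. -/
structure WeightedDigraph (N : ℕ) where
  weight : Matrix (Fin N) (Fin N) ℝ
  nonneg : ∀ i j, 0 ≤ weight i j
  loopless : ∀ i, weight i i = 0

namespace WeightedDigraph

variable {N : ℕ}

/-- `G.IsParent j i`: there is an edge from `j` to `i`. -/
def IsParent (G : WeightedDigraph N) (j i : Fin N) : Prop := 0 < G.weight i j

/-- The Laplacian matrix. -/
def laplacian (G : WeightedDigraph N) : Matrix (Fin N) (Fin N) ℝ :=
  fun i j => if i = j then ∑ k, G.weight i k else -G.weight i j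

/-- The whole graph is a directed tree with root `r`: the root has no parent, each other node has
exactly one parent, and the root has a directed path to every node. -/
def IsDirectedTree (G : WeightedDigraph N) (r : Fin N) : Prop :=
  (∀ j, ¬ G.IsParent j r) ∧ (∀ i, i ≠ r → ∃! j, G.IsParent j i) ∧
    ∀ i, Relation.ReflTransGen G.IsParent r i

/-- `G.PathDelay τ r i d`: there is a directed path from `r` to `i` along which the communication
delays add up to `d`; here `τ i j` is the delay of the edge from `j` to `i`. -/
inductive PathDelay (G : WeightedDigraph N) (τ : Fin N → Fin N → ℝ) (r : Fin N) :
    Fin N → ℝ → Prop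
  | root : PathDelay G τ r r 0
  | step {i j : Fin N} {d : ℝ} (h : PathDelay G τ r j d) (e : G.IsParent j i) :
      PathDelay G τ r i (d + τ i j)

/-- In a directed tree the accumulated delay from the root to a node exists and is unique. -/
theorem IsDirectedTree.existsUnique_pathDelay {G : WeightedDigraph N} {r : Fin N}
    (hG : G.IsDirectedTree r) (τ : Fin N → Fin N → ℝ) (i : Fin N) :
    ∃! d, G.PathDelay τ r i d := by
  have hex : ∃ d, G.PathDelay τ r i d := by
    induction hG.2.2 i with
    | refl => exact ⟨0, .root⟩
    | tail _ e ih => obtain ⟨d, hd⟩ := ih; exact ⟨_, .step hd e⟩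
  have huniq : ∀ i d, G.PathDelay τ r i d → ∀ d', G.PathDelay τ r i d' → d' = d := by
    intro i d h
    induction h with
    | root =>
      intro d' h'
      cases h' with
      | root => rfl
      | step _ e => exact absurd e (hG.1 _)
    | @step i j d h e ih =>
      intro d' h'
      cases h' with
      | root => exact absurd e (hG.1 _)
      | @step _ j' d'' h'' e' =>
        have hi : i ≠ r := by rintro rfl; exact hG.1 _ e
        obtain rfl : j' = j := (hG.2.1 i hi).unique e' e
        rw [ih _ h'']
  obtain ⟨d, hd⟩ := hex
  exact ⟨d, hd, fun d' h' => huniq i d hd d' h'⟩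

end WeightedDigraph

/-- The set `𝔾_{α,β}^N` of directed graphs with `N` nodes that are equal to a directed spanning
tree rooted at the first agent and whose Laplacian is lower triangular, has zero top row, and
satisfies `β ≤ ℓ_{ii} ≤ α` for all agents `i` other than the root. -/
def spanningTreeGraphs (N : ℕ) [NeZero N] (α β : ℝ) : Set (WeightedDigraph N) :=
  {G | G.IsDirectedTree 0 ∧ (∀ j, G.laplacian 0 j = 0) ∧
    (∀ i j, i < j → G.laplacian i j = 0) ∧
    ∀ i, i ≠ 0 → β ≤ G.laplacian i i ∧ G.laplacian i i ≤ α}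

/-! ### The closed loop and delayed synchronization -/

/-- The network measurement `ζ_i(t) = ∑_j a_{ij} (y_i(t) - y_j(t - τ_{ij}))`, with `y_i = C x_i`. -/
def networkMeasurement {N n p : ℕ} (C : Matrix (Fin p) (Fin n) ℝ) (G : WeightedDigraph N)
    (τ : Fin N → Fin N → ℝ) (x : Fin N → ℝ → Fin n → ℝ) (i : Fin N) (t : ℝ) : Fin p → ℝ :=
  ∑ j, G.weight i j • (C *ᵥ x i t - C *ᵥ x j (t - τ i j))

/-- A dynamic protocol `χ̇ = A_c χ + B_c ζ`, `u = C_c χ + D_c ζ` with `q` states. -/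
structure DynamicProtocol (m p q : ℕ) where
  Ac : Matrix (Fin q) (Fin q) ℝ
  Bc : Matrix (Fin q) (Fin p) ℝ
  Cc : Matrix (Fin m) (Fin q) ℝ
  Dc : Matrix (Fin m) (Fin p) ℝ

/-- `x` (agent states) and `χ` (protocol states) form a trajectory, on the time axis `t ≥ 0`, of the
agents `ẋ_i = A x_i + B u_i`, `y_i = C x_i` coupled through the delayed network and the protocol.
The values of `x` at negative times are the initial history and are not restricted. The derivatives
are right derivatives, so that classical solutions with a continuous history are included, and
also the solutions with a history that jumps (where the derivative may jump when the jump arrives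
at another agent). -/
structure IsTrajectory {N n m p q : ℕ} (A : Matrix (Fin n) (Fin n) ℝ)
    (B : Matrix (Fin n) (Fin m) ℝ) (C : Matrix (Fin p) (Fin n) ℝ) (D : DynamicProtocol m p q)
    (G : WeightedDigraph N) (τ : Fin N → Fin N → ℝ)
    (x : Fin N → ℝ → Fin n → ℝ) (χ : Fin N → ℝ → Fin q → ℝ) : Prop where
  continuousOn_state : ∀ i, ContinuousOn (x i) (Ici 0)
  continuousOn_protocol : ∀ i, ContinuousOn (χ i) (Ici 0)
  state_eq : ∀ i, ∀ t, 0 ≤ t → HasDerivWithinAt (x i)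
    (A *ᵥ x i t + B *ᵥ (D.Cc *ᵥ χ i t + D.Dc *ᵥ networkMeasurement C G τ x i t)) (Ici t) t
  protocol_eq : ∀ i, ∀ t, 0 ≤ t → HasDerivWithinAt (χ i)
    (D.Ac *ᵥ χ i t + D.Bc *ᵥ networkMeasurement C G τ x i t) (Ici t) t

/-- Delayed state synchronization: `x_i(t) - x_j(t - τ_{ij}) → 0` for all agents `i`, `j`, where
`τ_{ij}` is, for an arbitrary pair, the difference of the accumulated delays from the root to `i`
and to `j` (for an edge from `j` to `i` this is the communication delay of the edge). -/
def DelayedStateSynchronization {N n : ℕ} [NeZero N] (G : WeightedDigraph N)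
    (τ : Fin N → Fin N → ℝ) (x : Fin N → ℝ → Fin n → ℝ) : Prop :=
  ∀ i j di dj, G.PathDelay τ 0 i di → G.PathDelay τ 0 j dj →
    Tendsto (fun t => x i t - x j (t - (di - dj))) atTop (𝓝 0)

/-- For an edge from `j` to `i` the synchronization error uses the delay of that edge. -/
theorem DelayedStateSynchronization.edge {N n : ℕ} [NeZero N] {G : WeightedDigraph N}
    {τ : Fin N → Fin N → ℝ} {x : Fin N → ℝ → Fin n → ℝ}
    (h : DelayedStateSynchronization G τ x) (hG : G.IsDirectedTree 0) {i j : Fin N}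
    (e : G.IsParent j i) : Tendsto (fun t => x i t - x j (t - τ i j)) atTop (𝓝 0) := by
  obtain ⟨d, hd, -⟩ := hG.existsUnique_pathDelay τ j
  simpa using h i j _ _ (.step hd e) hd

/-- The protocol achieves delayed state synchronization for every graph of the set `𝒢`, for all
nonnegative constant communication delays, and for all initial data. -/
def SolvesDelayedStateSynchronization {N n m p q : ℕ} [NeZero N] (A : Matrix (Fin n) (Fin n) ℝ)
    (B : Matrix (Fin n) (Fin m) ℝ) (C : Matrix (Fin p) (Fin n) ℝ)
    (𝒢 : Set (WeightedDigraph N)) (D : DynamicProtocol m p q) : Prop :=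
  ∀ G ∈ 𝒢, ∀ τ : Fin N → Fin N → ℝ, (∀ i j, 0 ≤ τ i j) →
    ∀ x χ, IsTrajectory A B C D G τ x χ → DelayedStateSynchronization G τ x

/-- The observer-based protocol `χ̇ = (A + K C) χ - K ζ`, `u = -β⁻¹ Bᵀ P χ`. -/
noncomputable def observerProtocol {n m p : ℕ} (A : Matrix (Fin n) (Fin n) ℝ)
    (B : Matrix (Fin n) (Fin m) ℝ) (C : Matrix (Fin p) (Fin n) ℝ) (K : Matrix (Fin n) (Fin p) ℝ)
    (β : ℝ) (P : Matrix (Fin n) (Fin n) ℝ) : DynamicProtocol m p n where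
  Ac := A + K * C
  Bc := -K
  Cc := -(β⁻¹ • (Bᵀ * P))
  Dc := 0

/-- `x_s(t) = (I 0) e^{Ā t} (x₀, χ₀)` with `Ā = (A, B C_c; 0, A_c)`. -/
noncomputable def rootTrajectory {n m p q : ℕ} (A : Matrix (Fin n) (Fin n) ℝ)
    (B : Matrix (Fin n) (Fin m) ℝ) (D : DynamicProtocol m p q) (x₀ : Fin n → ℝ) (χ₀ : Fin q → ℝ)
    (t : ℝ) : Fin n → ℝ :=
  fun k => (NormedSpace.exp (t • Matrix.fromBlocks A (B * D.Cc) 0 D.Ac) *ᵥ Sum.elim x₀ χ₀)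
    (Sum.inl k)

end MAS

/-!
In delay-shifted time `x_i(t + τ̄_i)` the delays disappear from a directed tree: an agent `i` with
parent `j` and edge weight `a` only sees `e = x_i(t + τ̄_i) - x_j(t + τ̄_j)`. The pair `(e, χ_i)`
then obeys a linear system forced by the parent's input, which is proportional to `χ_j`. So if
every such pair system is stable, the convergences `χ_j → 0` and `x_j(t + τ̄_j) - x_0(t) → 0`
propagate along the tree (`IsTrajectory.tendsto_of_pathDelay`). At the root, `χ_0 → 0` because
`A + K C` is Hurwitz stable.

In the coordinates `(a e, a e - χ_i)` the pair system depends on the graph only through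
`ρ = a / β ∈ [1, α / β]`. Up to terms that are small with `P` it is block triangular, with the
diagonal blocks `A - ρ B Bᵀ P` and `A + K C`. `exists_isLyapunovStable_fromBlocks` shows that
`diag(P, c Q)`, with `Q` a Lyapunov matrix of `A + K C`, is a Lyapunov matrix for it, uniformly in
`ρ`, as soon as `P` is small. Smallness for small `δ` is `exists_forall_dotProduct_le`: the
solutions `P_δ` decrease to a positive semidefinite solution `P` of the equation with `δ = 0`. If
`P` were nonzero, its range would contain a (complex) eigenvector of `Aᵀ`; since `A` has no
eigenvalue in the open right half plane, the equation forces this eigenvector into the kernel of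
`Bᵀ` and its eigenvalue onto the imaginary axis, which contradicts stabilizability
(`eq_zero_of_riccati_zero`).

Stability is handled throughout in the form `IsLyapunovStable`, the existence of a quadratic
Lyapunov function, and is related to eigenvalues in `IsHurwitz.isLyapunovStable` and
`IsLyapunovStable.isHurwitz`. Decay of the flow of stable matrices yields uniqueness for Sylvester
equations and hence solvability of Lyapunov equations. The latter give the observer gain
(`exists_isHurwitz_of_isObservable`) and, through Kleinman's iteration, the solution of the Riccati
equation (`exists_isLowGainRiccatiSolution`).
-/

namespace MAS

/-! ### Quadratic forms of real matrices -/

section Forms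

variable {ι κ : Type*} [Fintype ι] [Fintype κ]

theorem mulVec_dotProduct (M : Matrix κ ι ℝ) (x : ι → ℝ) (y : κ → ℝ) :
    (M *ᵥ x) ⬝ᵥ y = x ⬝ᵥ Mᵀ *ᵥ y := by
  rw [dotProduct_comm, dotProduct_mulVec, ← mulVec_transpose, dotProduct_comm]

theorem real_dotProduct_self_nonneg (x : ι → ℝ) : 0 ≤ x ⬝ᵥ x :=
  Finset.sum_nonneg fun i _ => mul_self_nonneg (x i)

theorem real_dotProduct_self_pos {x : ι → ℝ} (hx : x ≠ 0) : 0 < x ⬝ᵥ x :=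
  lt_of_le_of_ne (real_dotProduct_self_nonneg x) fun h => hx (dotProduct_self_eq_zero.1 h.symm)

theorem dotProduct_mulVec_comm {Q : Matrix ι ι ℝ} (hQ : Qᵀ = Q) (x y : ι → ℝ) :
    x ⬝ᵥ Q *ᵥ y = y ⬝ᵥ Q *ᵥ x := by
  rw [dotProduct_comm, mulVec_dotProduct, hQ]

theorem posDef_iff_real {Q : Matrix ι ι ℝ} :
    Q.PosDef ↔ Qᵀ = Q ∧ ∀ x, x ≠ 0 → 0 < x ⬝ᵥ Q *ᵥ x := by
  rw [posDef_iff_dotProduct_mulVec]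
  rw [IsHermitian, conjTranspose_eq_transpose_of_trivial]
  simp

/-- The quadratic form of `Mᵀ Q + Q M` is the derivative of `x ↦ xᵀ Q x` along `ẋ = M x`. -/
theorem dotProduct_lyapunov {Q : Matrix ι ι ℝ} (hQ : Qᵀ = Q) (M : Matrix ι ι ℝ) (x : ι → ℝ) :
    x ⬝ᵥ (Mᵀ * Q + Q * M) *ᵥ x = 2 * (x ⬝ᵥ Q *ᵥ (M *ᵥ x)) := by
  rw [add_mulVec, dotProduct_add, ← mulVec_mulVec, ← mulVec_mulVec, ← mulVec_dotProduct,
    dotProduct_mulVec_comm hQ (M *ᵥ x) x]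
  ring

/-- A crude bound of a quadratic form, which tends to zero with the matrix. -/
theorem dotProduct_mulVec_le (X : Matrix ι ι ℝ) (x : ι → ℝ) :
    x ⬝ᵥ X *ᵥ x ≤ (∑ i, ∑ j, |X i j|) * (x ⬝ᵥ x) := by
  have h1 (i) : x i * x i ≤ x ⬝ᵥ x := Finset.single_le_sum
    (f := fun i => x i * x i) (fun i _ => mul_self_nonneg (x i)) (Finset.mem_univ i)
  generalize x ⬝ᵥ x = s at h1 ⊢
  simp only [mulVec, dotProduct, Finset.sum_mul, Finset.mul_sum]
  refine Finset.sum_le_sum fun i _ => Finset.sum_le_sum fun j _ => ?_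
  have h2 : |x i| * |x j| ≤ s := by
    nlinarith [h1 i, h1 j, sq_nonneg (|x i| - |x j|), abs_mul_abs_self (x i),
      abs_mul_abs_self (x j)]
  calc x i * (X i j * x j) ≤ |x i * (X i j * x j)| := le_abs_self _
    _ = |X i j| * (|x i| * |x j|) := by rw [abs_mul, abs_mul]; ring
    _ ≤ |X i j| * s := by gcongr

/-- Polarization: the entries of a symmetric matrix in terms of its quadratic form. -/
theorem apply_eq_polarization [DecidableEq ι] {X : Matrix ι ι ℝ} (hX : Xᵀ = X) (i j : ι) :
    X i j = ((Pi.single i 1 + Pi.single j 1) ⬝ᵥ X *ᵥ (Pi.single i 1 + Pi.single j 1) -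
      (Pi.single i 1 - Pi.single j 1) ⬝ᵥ X *ᵥ (Pi.single i 1 - Pi.single j 1)) / 4 := by
  have h : X j i = X i j := congrFun (congrFun hX i) j
  simp [mulVec_add, mulVec_sub, add_dotProduct, sub_dotProduct, dotProduct_add, dotProduct_sub, h]
  ring

theorem eq_of_forall_dotProduct {X Y : Matrix ι ι ℝ} (hX : Xᵀ = X) (hY : Yᵀ = Y)
    (h : ∀ x, x ⬝ᵥ X *ᵥ x = x ⬝ᵥ Y *ᵥ x) : X = Y := by
  classical
  ext i j
  rw [apply_eq_polarization hX, apply_eq_polarization hY, h, h]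

/-- A positive quadratic form is bounded below on the unit sphere, by compactness. -/
theorem exists_pos_mul_le_dotProduct {S : Matrix ι ι ℝ} (hS : ∀ x, x ≠ 0 → 0 < x ⬝ᵥ S *ᵥ x) :
    ∃ c > 0, ∀ x, c * (x ⬝ᵥ x) ≤ x ⬝ᵥ S *ᵥ x := by
  have hcomp : IsCompact {x : ι → ℝ | x ⬝ᵥ x = 1} := by
    refine Metric.isCompact_of_isClosed_isBounded
      (isClosed_eq (by simp only [dotProduct]; fun_prop) continuous_const) ?_
    refine (Metric.isBounded_closedBall (x := (0 : ι → ℝ)) (r := 1)).subset fun x hx => ?_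
    rw [mem_closedBall_zero_iff, pi_norm_le_iff_of_nonneg zero_le_one]
    intro i
    have h1 : x i * x i ≤ 1 := hx ▸ Finset.single_le_sum (f := fun i => x i * x i)
      (fun i _ => mul_self_nonneg (x i)) (Finset.mem_univ i)
    rw [Real.norm_eq_abs]
    exact abs_le_one_iff_mul_self_le_one.2 h1
  have key : ∃ c > 0, ∀ x : ι → ℝ, x ⬝ᵥ x = 1 → c ≤ x ⬝ᵥ S *ᵥ x := by
    rcases {x : ι → ℝ | x ⬝ᵥ x = 1}.eq_empty_or_nonempty with h | h
    · exact ⟨1, one_pos, fun x hx => absurd hx (fun hx => (h ▸ hx : x ∈ (∅ : Set (ι → ℝ))))⟩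
    · obtain ⟨x, hx, hmin⟩ := hcomp.exists_isMinOn h (f := fun x => x ⬝ᵥ S *ᵥ x)
        (by simp only [dotProduct, mulVec]; fun_prop)
      refine ⟨x ⬝ᵥ S *ᵥ x, hS x ?_, fun y hy => hmin hy⟩
      rintro rfl
      simp at hx
  obtain ⟨c, hc, h⟩ := key
  refine ⟨c, hc, fun x => ?_⟩
  by_cases hx : x = 0
  · simp [hx]
  have hp := real_dotProduct_self_pos hx
  have hs : (√(x ⬝ᵥ x)) ^ 2 = x ⬝ᵥ x := Real.sq_sqrt hp.le
  have hr : 0 < √(x ⬝ᵥ x) := Real.sqrt_pos.2 hp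
  have := h ((√(x ⬝ᵥ x))⁻¹ • x) (by
    simp only [smul_dotProduct, dotProduct_smul, smul_eq_mul]
    field_simp; exact hs.symm)
  simp only [mulVec_smul, smul_dotProduct, dotProduct_smul, smul_eq_mul] at this
  field_simp at this
  rwa [hs] at this

theorem two_mul_dotProduct_le {P : Matrix ι ι ℝ} (hP : Pᵀ = P)
    (h0 : ∀ x, 0 ≤ x ⬝ᵥ P *ᵥ x) (x y : ι → ℝ) :
    2 * (x ⬝ᵥ P *ᵥ y) ≤ x ⬝ᵥ P *ᵥ x + y ⬝ᵥ P *ᵥ y := by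
  have := h0 (x - y)
  simp only [mulVec_sub, sub_dotProduct, dotProduct_sub, dotProduct_mulVec_comm hP y x] at this
  linarith

theorem mulVec_eq_zero_of_dotProduct {P : Matrix ι ι ℝ} (hP : Pᵀ = P)
    (h0 : ∀ x, 0 ≤ x ⬝ᵥ P *ᵥ x) {x : ι → ℝ} (hx : x ⬝ᵥ P *ᵥ x = 0) : P *ᵥ x = 0 := by
  have hP' : P.PosSemidef := posSemidef_iff_dotProduct_mulVec.2
    ⟨by rw [IsHermitian, conjTranspose_eq_transpose_of_trivial, hP], by simpa using h0⟩
  exact (hP'.dotProduct_mulVec_zero_iff x).1 (by simpa using hx)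

end Forms

/-! ### Lyapunov functions and forced linear systems -/

section Flow

variable {ι : Type*} [Fintype ι]

theorem hasDerivWithinAt_dotProduct {x y : ℝ → ι → ℝ} {x' y' : ι → ℝ} {s : Set ℝ} {t : ℝ}
    (hx : HasDerivWithinAt x x' s t) (hy : HasDerivWithinAt y y' s t) :
    HasDerivWithinAt (fun t => x t ⬝ᵥ y t) (x' ⬝ᵥ y t + x t ⬝ᵥ y') s t := by
  rw [hasDerivWithinAt_pi] at hx hy
  have := HasDerivWithinAt.fun_sum (u := Finset.univ) fun i _ => (hx i).mul (hy i)
  simpa [_root_.dotProduct, Finset.sum_add_distrib] using this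

theorem hasDerivWithinAt_mulVec {κ : Type*} [Fintype κ] (M : Matrix κ ι ℝ) {x : ℝ → ι → ℝ}
    {x' : ι → ℝ} {s : Set ℝ} {t : ℝ} (hx : HasDerivWithinAt x x' s t) :
    HasDerivWithinAt (fun t => M *ᵥ x t) (M *ᵥ x') s t :=
  (LinearMap.toContinuousLinearMap M.mulVecLin).hasFDerivAt.comp_hasDerivWithinAt t hx

/-- A nonnegative function with `V' ≤ -k V + g` and `g → 0` tends to zero, by Grönwall's inequality
with the negative constant `-k`. -/
theorem tendsto_zero_of_deriv_le {V V' g : ℝ → ℝ} {k : ℝ} (hk : 0 < k)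
    (hV : ContinuousOn V (Ici 0)) (h0 : ∀ t, 0 ≤ t → 0 ≤ V t)
    (hd : ∀ t, 0 ≤ t → HasDerivWithinAt V (V' t) (Ici t) t)
    (hle : ∀ t, 0 ≤ t → V' t ≤ -k * V t + g t) (hg : Tendsto g atTop (𝓝 0)) :
    Tendsto V atTop (𝓝 0) := by
  rw [tendsto_order]
  refine ⟨fun a ha => (eventually_ge_atTop 0).mono fun t ht => ha.trans_le (h0 t ht), ?_⟩
  intro ε hε
  obtain ⟨T, hT0, hT⟩ : ∃ T, 0 ≤ T ∧ ∀ t, T ≤ t → g t ≤ k * (ε / 2) := by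
    obtain ⟨T, hT⟩ := eventually_atTop.1 (hg.eventually
      (ge_mem_nhds (by positivity : 0 < k * (ε / 2))))
    exact ⟨max T 0, le_max_right _ _, fun t ht => hT t ((le_max_left _ _).trans ht)⟩
  have hb : ∀ t, T ≤ t → V t ≤ V T * Real.exp (-k * (t - T)) + ε / 2 := by
    intro t ht
    have := le_gronwallBound_of_liminf_deriv_right_le (f := V) (f' := V') (δ := V T) (K := -k)
      (ε := k * (ε / 2)) (a := T) (b := t)
      (hV.mono fun s hs => hT0.trans hs.1)
      (fun x hx r hr => (hd x (hT0.trans hx.1)).liminf_right_slope_le hr)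
      le_rfl (fun x hx => (hle x (hT0.trans hx.1)).trans (by linarith [hT x hx.1])) t ⟨ht, le_rfl⟩
    rw [gronwallBound_of_K_ne_0 (by linarith : -k ≠ 0)] at this
    refine this.trans ?_
    have hkk : k * (ε / 2) / -k = -(ε / 2) := by field_simp
    rw [hkk]
    nlinarith [Real.exp_pos (-k * (t - T))]
  have hlim : Tendsto (fun t => V T * Real.exp (-k * (t - T)) + ε / 2) atTop
      (𝓝 (V T * 0 + ε / 2)) := by
    refine ((Real.tendsto_exp_atBot.comp ?_).const_mul _).add_const _
    exact (tendsto_atTop_add_const_right _ _ tendsto_id).const_mul_atTop_of_neg (by linarith)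
  filter_upwards [hlim.eventually (gt_mem_nhds (by linarith : V T * 0 + ε / 2 < ε)),
    eventually_ge_atTop T] with t h1 h2 using (hb t h2).trans_lt h1

/-- Lyapunov stability: some positive definite quadratic form strictly decreases along the nonzero
solutions of `ẋ = M x`. -/
def IsLyapunovStable (M : Matrix ι ι ℝ) : Prop :=
  ∃ Q : Matrix ι ι ℝ, Q.PosDef ∧ ∀ x, x ≠ 0 → x ⬝ᵥ Q *ᵥ (M *ᵥ x) < 0

theorem tendsto_zero_of_dotProduct {z : ℝ → ι → ℝ}
    (h : Tendsto (fun t => z t ⬝ᵥ z t) atTop (𝓝 0)) : Tendsto z atTop (𝓝 0) := by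
  rw [tendsto_pi_nhds]
  intro i
  have h2 : Tendsto (fun t => z t i * z t i) atTop (𝓝 0) :=
    squeeze_zero (fun t => mul_self_nonneg _) (fun t => Finset.single_le_sum
      (f := fun i => z t i * z t i) (fun i _ => mul_self_nonneg (z t i)) (Finset.mem_univ i)) h
  have h3 := h2.sqrt
  simp only [Real.sqrt_mul_self_eq_abs, Real.sqrt_zero] at h3
  exact (tendsto_zero_iff_abs_tendsto_zero _).2 h3

/-- Solutions of a stable linear system with a vanishing forcing term tend to zero. -/
theorem IsLyapunovStable.tendsto_zero {M : Matrix ι ι ℝ} (hM : IsLyapunovStable M)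
    {z f : ℝ → ι → ℝ} (hz : ContinuousOn z (Ici 0))
    (hd : ∀ t, 0 ≤ t → HasDerivWithinAt z (M *ᵥ z t + f t) (Ici t) t)
    (hf : Tendsto f atTop (𝓝 0)) : Tendsto z atTop (𝓝 0) := by
  obtain ⟨Q, hQ, hneg⟩ := hM
  obtain ⟨hQs, hQp⟩ := posDef_iff_real.1 hQ
  obtain ⟨c, hc, hcQ⟩ := exists_pos_mul_le_dotProduct hQp
  obtain ⟨b, hb, hbM⟩ := exists_pos_mul_le_dotProduct (S := -(Q * M)) fun x hx => by
    rw [neg_mulVec, dotProduct_neg, ← mulVec_mulVec]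
    linarith [hneg x hx]
  obtain ⟨K, hK, hQK⟩ : ∃ K > 0, ∀ x : ι → ℝ, x ⬝ᵥ Q *ᵥ x ≤ K * (x ⬝ᵥ x) :=
    ⟨(∑ i, ∑ j, |Q i j|) + 1, by positivity, fun x => (dotProduct_mulVec_le Q x).trans (by
      nlinarith [real_dotProduct_self_nonneg x])⟩
  have hV : Tendsto (fun t => z t ⬝ᵥ Q *ᵥ z t) atTop (𝓝 0) := by
    refine tendsto_zero_of_deriv_le (k := b / K)
      (V' := fun t => (M *ᵥ z t + f t) ⬝ᵥ Q *ᵥ z t + z t ⬝ᵥ Q *ᵥ (M *ᵥ z t + f t))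
      (g := fun t => b⁻¹ * ((Q *ᵥ f t) ⬝ᵥ (Q *ᵥ f t))) (by positivity) ?_ ?_ ?_ ?_ ?_
    · have : Continuous fun x : ι → ℝ => x ⬝ᵥ Q *ᵥ x := by
        simp only [dotProduct, mulVec]; fun_prop
      exact this.comp_continuousOn hz
    · exact fun t _ => (mul_nonneg hc.le (real_dotProduct_self_nonneg _)).trans (hcQ _)
    · exact fun t ht => hasDerivWithinAt_dotProduct (hd t ht) (hasDerivWithinAt_mulVec Q (hd t ht))
    · intro t _
      rw [dotProduct_mulVec_comm hQs (M *ᵥ z t + f t)]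
      have h1 := hbM (z t)
      rw [neg_mulVec, dotProduct_neg, ← mulVec_mulVec] at h1
      have h2 := real_dotProduct_self_nonneg (b • z t - Q *ᵥ f t)
      have h3 := hQK (z t)
      rw [mulVec_add, dotProduct_add]
      simp only [sub_dotProduct, dotProduct_sub, smul_dotProduct, dotProduct_smul, smul_eq_mul,
        dotProduct_comm (Q *ᵥ f t) (z t)] at h2
      have h4 : b / K * (z t ⬝ᵥ Q *ᵥ z t) ≤ b * (z t ⬝ᵥ z t) := by
        rw [div_mul_eq_mul_div, div_le_iff₀ hK]; nlinarith
      have h5 : 2 * (z t ⬝ᵥ Q *ᵥ f t) ≤ b * (z t ⬝ᵥ z t) + b⁻¹ * ((Q *ᵥ f t) ⬝ᵥ (Q *ᵥ f t)) := by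
        rw [← mul_le_mul_iff_right₀ hb]
        field_simp
        nlinarith
      nlinarith
    · have : Continuous fun x : ι → ℝ => b⁻¹ * ((Q *ᵥ x) ⬝ᵥ (Q *ᵥ x)) := by
        simp only [dotProduct, mulVec]; fun_prop
      have := (this.tendsto 0).comp hf
      simpa [Function.comp_def] using this
  refine tendsto_zero_of_dotProduct ?_
  refine squeeze_zero (g := fun t => c⁻¹ * (z t ⬝ᵥ Q *ᵥ z t))
    (fun t => real_dotProduct_self_nonneg _) (fun t => ?_) (by simpa using hV.const_mul c⁻¹)
  rw [← div_eq_inv_mul, le_div_iff₀ hc]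
  linarith [hcQ (z t)]

end Flow

/-! ### Sylvester and Lyapunov equations -/

section Exponential

variable {ι κ : Type*} [Fintype ι] [DecidableEq ι] [Fintype κ] [DecidableEq κ]

theorem hasDerivAt_exp_mulVec (M : Matrix ι ι ℝ) (x : ι → ℝ) (t : ℝ) :
    HasDerivAt (fun t : ℝ => NormedSpace.exp (t • M) *ᵥ x)
      (M *ᵥ (NormedSpace.exp (t • M) *ᵥ x)) t := by
  let : NormedRing (Matrix ι ι ℝ) := Matrix.linftyOpNormedRing
  let : NormedAlgebra ℝ (Matrix ι ι ℝ) := Matrix.linftyOpNormedAlgebra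
  have h := hasDerivAt_exp_smul_const' M t
  have := (LinearMap.toContinuousLinearMap
    ((Matrix.mulVecBilin ℝ ℝ).flip x : Matrix ι ι ℝ →ₗ[ℝ] ι → ℝ)).hasFDerivAt.comp_hasDerivAt t h
  rw [mulVec_mulVec]
  exact this

theorem IsLyapunovStable.tendsto_exp {M : Matrix ι ι ℝ} (hM : IsLyapunovStable M) (x : ι → ℝ) :
    Tendsto (fun t : ℝ => NormedSpace.exp (t • M) *ᵥ x) atTop (𝓝 0) :=
  hM.tendsto_zero (f := fun _ => 0)
    (fun t _ => (hasDerivAt_exp_mulVec M x t).continuousAt.continuousWithinAt)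
    (fun t _ => by simpa using (hasDerivAt_exp_mulVec M x t).hasDerivWithinAt) tendsto_const_nhds

theorem hasDerivAt_dotProduct_exp (M₁ : Matrix ι ι ℝ) (M₂ : Matrix κ κ ℝ) (X : Matrix ι κ ℝ)
    (x : ι → ℝ) (y : κ → ℝ) (t : ℝ) :
    HasDerivAt (fun t : ℝ => (NormedSpace.exp (t • M₁) *ᵥ x) ⬝ᵥ
        X *ᵥ (NormedSpace.exp (t • M₂) *ᵥ y))
      ((NormedSpace.exp (t • M₁) *ᵥ x) ⬝ᵥ
        (M₁ᵀ * X + X * M₂) *ᵥ (NormedSpace.exp (t • M₂) *ᵥ y)) t := by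
  have h := hasDerivWithinAt_dotProduct (hasDerivAt_exp_mulVec M₁ x t).hasDerivWithinAt
    (hasDerivWithinAt_mulVec X (hasDerivAt_exp_mulVec M₂ y t).hasDerivWithinAt) (s := univ)
  rw [hasDerivWithinAt_univ] at h
  refine h.congr_deriv ?_
  rw [add_mulVec, dotProduct_add, ← mulVec_mulVec, ← mulVec_mulVec, mulVec_dotProduct M₁]

theorem IsLyapunovStable.tendsto_dotProduct_exp {M₁ : Matrix ι ι ℝ} {M₂ : Matrix κ κ ℝ}
    (h₁ : IsLyapunovStable M₁) (h₂ : IsLyapunovStable M₂) (X : Matrix ι κ ℝ)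
    (x : ι → ℝ) (y : κ → ℝ) :
    Tendsto (fun t : ℝ => (NormedSpace.exp (t • M₁) *ᵥ x) ⬝ᵥ
        X *ᵥ (NormedSpace.exp (t • M₂) *ᵥ y)) atTop (𝓝 0) := by
  have hc : Continuous fun p : (ι → ℝ) × (κ → ℝ) => p.1 ⬝ᵥ X *ᵥ p.2 := by
    simp only [dotProduct, mulVec]; fun_prop
  have := (hc.tendsto (0, 0)).comp ((h₁.tendsto_exp x).prodMk_nhds (h₂.tendsto_exp y))
  simpa [Function.comp_def] using this

/-- The Sylvester equation `M₁ᵀ X + X M₂ = 0` with stable matrices has only the zero solution: the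
bilinear form of `X` is constant along the two flows, which tend to zero. -/
theorem IsLyapunovStable.eq_zero_of_sylvester {M₁ : Matrix ι ι ℝ} {M₂ : Matrix κ κ ℝ}
    (h₁ : IsLyapunovStable M₁) (h₂ : IsLyapunovStable M₂) {X : Matrix ι κ ℝ}
    (hX : M₁ᵀ * X + X * M₂ = 0) : X = 0 := by
  have hz (x : ι → ℝ) (y : κ → ℝ) : x ⬝ᵥ X *ᵥ y = 0 := by
    have hd := hasDerivAt_dotProduct_exp M₁ M₂ X x y
    simp only [hX, zero_mulVec, dotProduct_zero] at hd
    have hconst := is_const_of_deriv_eq_zero (fun t => (hd t).differentiableAt)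
      (fun t => (hd t).deriv)
    have hl := h₁.tendsto_dotProduct_exp h₂ X x y
    rw [funext fun t => hconst t 0, tendsto_const_nhds_iff] at hl
    simpa using hl
  ext i j
  simpa using hz (Pi.single i 1) (Pi.single j 1)

/-- If the quadratic form of `X` does not increase along the flow of a stable matrix, then it is
nonnegative, since its limit along the flow is zero. -/
theorem IsLyapunovStable.dotProduct_nonneg {M X : Matrix ι ι ℝ} (hM : IsLyapunovStable M)
    (hX : Xᵀ = X) (h : ∀ x, x ⬝ᵥ X *ᵥ (M *ᵥ x) ≤ 0) (x : ι → ℝ) : 0 ≤ x ⬝ᵥ X *ᵥ x := by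
  have hd := hasDerivAt_dotProduct_exp M M X x x
  have hanti := antitone_of_deriv_nonpos (fun t => (hd t).differentiableAt)
    (fun t => (hd t).deriv.trans_le (by
      rw [dotProduct_lyapunov hX]
      linarith [h (NormedSpace.exp (t • M) *ᵥ x)]))
  simpa using hanti.le_of_tendsto (hM.tendsto_dotProduct_exp hM X x x) 0

/-- The Lyapunov equation of a stable matrix is solvable, because the Lyapunov operator is injective
on a finite-dimensional space. -/
theorem IsLyapunovStable.exists_lyapunov {M : Matrix ι ι ℝ} (hM : IsLyapunovStable M)
    {S : Matrix ι ι ℝ} (hS : Sᵀ = S) (h0 : ∀ x, 0 ≤ x ⬝ᵥ S *ᵥ x) :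
    ∃ X, Xᵀ = X ∧ (∀ x, 0 ≤ x ⬝ᵥ X *ᵥ x) ∧ Mᵀ * X + X * M = -S := by
  let T : Matrix ι ι ℝ →ₗ[ℝ] Matrix ι ι ℝ :=
    LinearMap.mulLeft ℝ Mᵀ + LinearMap.mulRight ℝ M
  have hT (X) : T X = Mᵀ * X + X * M := rfl
  have hinj : Function.Injective T := by
    rw [injective_iff_map_eq_zero]
    exact fun X hX => hM.eq_zero_of_sylvester hM hX
  obtain ⟨X, hX⟩ := LinearMap.injective_iff_surjective.1 hinj (-S)
  have hXs : Xᵀ = X := hinj <| by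
    rw [hX, hT, ← hS, ← transpose_neg, ← hX, hT]
    simp [transpose_add, transpose_mul, add_comm]
  refine ⟨X, hXs, hM.dotProduct_nonneg hXs fun x => ?_, hX⟩
  have h1 := dotProduct_lyapunov hXs M x
  rw [← hT, hX, neg_mulVec, dotProduct_neg] at h1
  linarith [h0 x]

end Exponential

/-! ### Eigenvalues and Lyapunov functions -/

section Spectrum

variable {n : ℕ}

/-- The complex eigenvector equation of a real matrix, in real and imaginary parts. -/
theorem map_mulVec_eq_smul_iff {M : Matrix (Fin n) (Fin n) ℝ} {μ : ℂ} {z : Fin n → ℂ} :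
    M.map (algebraMap ℝ ℂ) *ᵥ z = μ • z ↔
      M *ᵥ (fun i => (z i).re) = μ.re • (fun i => (z i).re) - μ.im • (fun i => (z i).im) ∧
      M *ᵥ (fun i => (z i).im) = μ.im • (fun i => (z i).re) + μ.re • (fun i => (z i).im) := by
  simp only [funext_iff, ← forall_and]
  refine forall_congr' fun i => ?_
  rw [Complex.ext_iff]
  simp only [mulVec, dotProduct, Pi.smul_apply, Pi.sub_apply, Pi.add_apply, smul_eq_mul,
    Complex.mul_re, Complex.mul_im, Complex.re_sum, Complex.im_sum, map_apply,
    Complex.coe_algebraMap, Complex.ofReal_re, Complex.ofReal_im, zero_mul, sub_zero, add_zero]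
  rw [add_comm (μ.re * (z i).im)]

/-- Complex eigenvalues of a real matrix in terms of pairs of real vectors, the real and the
imaginary part of an eigenvector. -/
theorem mem_spectrum_iff_exists {M : Matrix (Fin n) (Fin n) ℝ} {μ : ℂ} :
    μ ∈ spectrum ℂ (M.map (algebraMap ℝ ℂ)) ↔ ∃ u v : Fin n → ℝ, (u ≠ 0 ∨ v ≠ 0) ∧
      M *ᵥ u = μ.re • u - μ.im • v ∧ M *ᵥ v = μ.im • u + μ.re • v := by
  have key (z : Fin n → ℂ) : (algebraMap ℂ _ μ - M.map (algebraMap ℝ ℂ)) *ᵥ z = 0 ↔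
      M.map (algebraMap ℝ ℂ) *ᵥ z = μ • z := by
    rw [sub_mulVec, sub_eq_zero, Algebra.algebraMap_eq_smul_one, smul_mulVec, one_mulVec, eq_comm]
  rw [spectrum.mem_iff, isUnit_iff_isUnit_det, isUnit_iff_ne_zero, not_not,
    ← exists_mulVec_eq_zero_iff]
  constructor
  · rintro ⟨z, hz, h⟩
    refine ⟨_, _, ?_, map_mulVec_eq_smul_iff.1 ((key z).1 h)⟩
    by_contra! h0
    exact hz (funext fun i => Complex.ext (congrFun h0.1 i) (congrFun h0.2 i))
  · rintro ⟨u, v, h0, h⟩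
    refine ⟨fun i => ⟨u i, v i⟩, ?_, (key _).2 (map_mulVec_eq_smul_iff.2 h)⟩
    intro h1
    have hu : u = 0 := funext fun i => congrArg Complex.re (congrFun h1 i)
    have hv : v = 0 := funext fun i => congrArg Complex.im (congrFun h1 i)
    simp [hu, hv] at h0

theorem mem_spectrum_transpose_iff {M : Matrix (Fin n) (Fin n) ℝ} {μ : ℂ} :
    μ ∈ spectrum ℂ (Mᵀ.map (algebraMap ℝ ℂ)) ↔ μ ∈ spectrum ℂ (M.map (algebraMap ℝ ℂ)) := by
  rw [mem_spectrum_iff_isRoot_charpoly, mem_spectrum_iff_isRoot_charpoly, transpose_map,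
    charpoly_transpose]

theorem IsLyapunovStable.isHurwitz {M : Matrix (Fin n) (Fin n) ℝ} (hM : IsLyapunovStable M) :
    IsHurwitz M := by
  intro μ hμ
  obtain ⟨u, v, h0, hu, hv⟩ := mem_spectrum_iff_exists.1 hμ
  obtain ⟨Q, hQ, hneg⟩ := hM
  obtain ⟨hQs, hQp⟩ := posDef_iff_real.1 hQ
  have hneg' (x) : x ⬝ᵥ Q *ᵥ (M *ᵥ x) ≤ 0 := by
    by_cases hx : x = 0
    · simp [hx]
    · exact (hneg x hx).le
  have hp' (x) : 0 ≤ x ⬝ᵥ Q *ᵥ x := by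
    by_cases hx : x = 0
    · simp [hx]
    · exact (hQp x hx).le
  have hsum : u ⬝ᵥ Q *ᵥ (M *ᵥ u) + v ⬝ᵥ Q *ᵥ (M *ᵥ v) =
      μ.re * (u ⬝ᵥ Q *ᵥ u + v ⬝ᵥ Q *ᵥ v) := by
    rw [hu, hv]
    simp only [mulVec_sub, mulVec_add, mulVec_smul, dotProduct_sub, dotProduct_add,
      dotProduct_smul, smul_eq_mul, dotProduct_mulVec_comm hQs v u]
    ring
  by_contra! hre
  rcases h0 with h0 | h0
  · nlinarith [hneg u h0, hneg' v, mul_nonneg hre (add_nonneg (hp' u) (hp' v))]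
  · nlinarith [hneg v h0, hneg' u, mul_nonneg hre (add_nonneg (hp' u) (hp' v))]

/-- By Gelfand's formula, the powers of a matrix with spectrum in the open unit disc tend to
zero. -/
theorem tendsto_pow_zero_of_spectrum {R : Matrix (Fin n) (Fin n) ℝ}
    (h : ∀ μ ∈ spectrum ℂ (R.map (algebraMap ℝ ℂ)), ‖μ‖ < 1) :
    Tendsto (fun k => R ^ k) atTop (𝓝 0) := by
  rcases isEmpty_or_nonempty (Fin n) with hn | hn
  · exact (tendsto_const_nhds (x := 0)).congr fun k => Subsingleton.elim _ _
  let : NormedRing (Matrix (Fin n) (Fin n) ℂ) := Matrix.linftyOpNormedRing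
  let : NormedAlgebra ℂ (Matrix (Fin n) (Fin n) ℂ) := Matrix.linftyOpNormedAlgebra
  have : CompleteSpace (Matrix (Fin n) (Fin n) ℂ) := FiniteDimensional.complete ℂ _
  set a := R.map (algebraMap ℝ ℂ) with ha
  have hr : spectralRadius ℂ a < (1 : NNReal) :=
    spectrum.spectralRadius_lt_of_forall_lt a fun z hz => by
      rw [← NNReal.coe_lt_coe]; simpa using h z hz
  obtain ⟨r, hr1, hr2⟩ := ENNReal.lt_iff_exists_nnreal_btwn.1 hr
  have hev := (spectrum.pow_nnnorm_pow_one_div_tendsto_nhds_spectralRadius a).eventually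
    (gt_mem_nhds hr1)
  have hpow : Tendsto (fun k => a ^ k) atTop (𝓝 0) := by
    refine tendsto_zero_iff_norm_tendsto_zero.2 ?_
    refine squeeze_zero' (Eventually.of_forall fun _ => norm_nonneg _) ?_
      (tendsto_pow_atTop_nhds_zero_of_lt_one r.2 (by exact_mod_cast hr2))
    filter_upwards [hev, eventually_gt_atTop 0] with k hk hk0
    have h1 := ENNReal.rpow_le_rpow hk.le (Nat.cast_nonneg k : (0 : ℝ) ≤ k)
    rw [← ENNReal.rpow_mul, one_div, inv_mul_cancel₀ (by positivity), ENNReal.rpow_one,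
      ENNReal.rpow_natCast] at h1
    have h2 : ‖a ^ k‖₊ ≤ r ^ k := by exact_mod_cast h1
    exact_mod_cast h2
  refine tendsto_pi_nhds.2 fun i => tendsto_pi_nhds.2 fun j => ?_
  have h1 := ((continuous_id.matrix_elem i j).tendsto _).comp hpow
  have h2 := (Complex.continuous_re.tendsto _).comp h1
  refine (h2.congr fun k => ?_).trans (by simp)
  simp only [Function.comp_apply, id, ha]
  rw [← RingHom.mapMatrix_apply, ← map_pow]
  simp

/-- For small `h > 0` the Euler step `R = 1 + h M` of a Hurwitz matrix `M` has its spectrum in the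
open unit disc. So some power `R ^ k` shrinks all nonzero vectors, the form of
`Q = ∑ j < k, (R ^ j)ᵀ R ^ j` decreases under `R`, and `Q` is a Lyapunov matrix for `M`. -/
theorem IsHurwitz.isLyapunovStable {M : Matrix (Fin n) (Fin n) ℝ} (hM : IsHurwitz M) :
    IsLyapunovStable M := by
  obtain ⟨h, hh, hlt⟩ : ∃ h : ℝ, 0 < h ∧
      ∀ μ ∈ spectrum ℂ (M.map (algebraMap ℝ ℂ)), ‖1 + h * μ‖ < 1 := by
    have : ∀ᶠ h : ℝ in 𝓝[>] 0, ∀ μ ∈ spectrum ℂ (M.map (algebraMap ℝ ℂ)), ‖1 + h * μ‖ < 1 := by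
      rw [Filter.eventually_all_finite (Matrix.finite_spectrum _)]
      intro μ hμ
      have hre := hM μ hμ
      have hc : Tendsto (fun h : ℝ => 2 * μ.re + h * (μ.re ^ 2 + μ.im ^ 2)) (𝓝[>] 0)
          (𝓝 (2 * μ.re + 0 * (μ.re ^ 2 + μ.im ^ 2))) :=
        ((by fun_prop : Continuous fun h : ℝ => 2 * μ.re + h * (μ.re ^ 2 + μ.im ^ 2)).tendsto
          0).mono_left nhdsWithin_le_nhds
      filter_upwards [hc.eventually (gt_mem_nhds (by linarith : _ < (0 : ℝ))),
        self_mem_nhdsWithin] with h h1 h2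
      have h2' : (0 : ℝ) < h := h2
      rw [← abs_of_nonneg (norm_nonneg (1 + (h : ℂ) * μ)), ← sq_lt_one_iff_abs_lt_one,
        Complex.sq_norm, Complex.normSq_apply]
      simp
      nlinarith
    obtain ⟨h, h1, h2⟩ := (this.and self_mem_nhdsWithin).exists
    exact ⟨h, h2, h1⟩
  set R : Matrix (Fin n) (Fin n) ℝ := 1 + h • M with hR
  have hRpow : Tendsto (fun k => R ^ k) atTop (𝓝 0) := by
    refine tendsto_pow_zero_of_spectrum fun μ hμ => ?_
    obtain ⟨u, v, h0, hu, hv⟩ := mem_spectrum_iff_exists.1 hμ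
    have hν : (μ - 1) / h ∈ spectrum ℂ (M.map (algebraMap ℝ ℂ)) := by
      refine mem_spectrum_iff_exists.2 ⟨u, v, h0, ?_, ?_⟩
      · rw [hR, add_mulVec, one_mulVec, smul_mulVec, ← eq_sub_iff_add_eq'] at hu
        rw [← inv_smul_smul₀ hh.ne' (M *ᵥ u), hu, Complex.div_ofReal_re, Complex.div_ofReal_im]
        ext i
        simp
        field_simp
        ring
      · rw [hR, add_mulVec, one_mulVec, smul_mulVec, ← eq_sub_iff_add_eq'] at hv
        rw [← inv_smul_smul₀ hh.ne' (M *ᵥ v), hv, Complex.div_ofReal_re, Complex.div_ofReal_im]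
        ext i
        simp
        field_simp
        ring
    have := hlt _ hν
    rwa [mul_div_cancel₀ _ (by exact_mod_cast hh.ne'), add_sub_cancel] at this
  obtain ⟨k, hk⟩ : ∃ k, ∀ x, x ≠ 0 → (R ^ k *ᵥ x) ⬝ᵥ (R ^ k *ᵥ x) < x ⬝ᵥ x := by
    have hc : Continuous fun X : Matrix (Fin n) (Fin n) ℝ => ∑ i, ∑ j, |(Xᵀ * X) i j| := by
      fun_prop
    have := ((hc.tendsto 0).comp hRpow).eventually (gt_mem_nhds (by simp : _ < (1 : ℝ)))
    obtain ⟨k, hk⟩ := this.exists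
    refine ⟨k, fun x hx => ?_⟩
    have h1 := dotProduct_mulVec_le ((R ^ k)ᵀ * R ^ k) x
    rw [← mulVec_mulVec, ← mulVec_dotProduct] at h1
    simp only [Function.comp_apply] at hk
    nlinarith [real_dotProduct_self_pos hx]
  let Q := ∑ j ∈ Finset.range k, (R ^ j)ᵀ * R ^ j
  have hQ (x : Fin n → ℝ) : x ⬝ᵥ Q *ᵥ x =
      ∑ j ∈ Finset.range k, (R ^ j *ᵥ x) ⬝ᵥ (R ^ j *ᵥ x) := by
    simp only [Q, sum_mulVec, dotProduct_sum, ← mulVec_mulVec, ← mulVec_dotProduct]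
  have hQs : Qᵀ = Q := by simp [Q, transpose_sum, transpose_mul]
  have hQ0 (x : Fin n → ℝ) : 0 ≤ x ⬝ᵥ Q *ᵥ x :=
    (hQ x).symm ▸ Finset.sum_nonneg fun j _ => real_dotProduct_self_nonneg _
  -- The sum defining `Q` telescopes.
  have hstep (x : Fin n → ℝ) : (R *ᵥ x) ⬝ᵥ Q *ᵥ (R *ᵥ x) - x ⬝ᵥ Q *ᵥ x =
      (R ^ k *ᵥ x) ⬝ᵥ (R ^ k *ᵥ x) - x ⬝ᵥ x := by
    rw [hQ, hQ, ← Finset.sum_sub_distrib]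
    simp only [mulVec_mulVec, ← pow_succ]
    rw [Finset.sum_range_sub (fun j => (R ^ j *ᵥ x) ⬝ᵥ (R ^ j *ᵥ x))]
    simp
  refine ⟨Q, posDef_iff_real.2 ⟨hQs, fun x hx => ?_⟩, fun x hx => ?_⟩
  · linarith [hstep x, hk x hx, hQ0 (R *ᵥ x)]
  · have h1 := hstep x
    rw [hR, add_mulVec, one_mulVec, smul_mulVec, ← hR] at h1
    simp only [mulVec_add, add_dotProduct, dotProduct_add, mulVec_smul, smul_dotProduct,
      dotProduct_smul, smul_eq_mul, dotProduct_mulVec_comm hQs (M *ᵥ x) x] at h1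
    have h2 := hQ0 (M *ᵥ x)
    have h3 := hk x hx
    by_contra! h4
    nlinarith [mul_nonneg hh.le h4, mul_nonneg (mul_nonneg hh.le hh.le) h2]

end Spectrum

/-! ### Observer gains -/

section Observer

variable {n p : ℕ}

theorem exists_isLyapunovStable_neg {ι : Type*} [Fintype ι] [DecidableEq ι] (A : Matrix ι ι ℝ) :
    ∃ r : ℝ, 0 < r ∧ IsLyapunovStable (-(A + r • (1 : Matrix ι ι ℝ))) := by
  refine ⟨(∑ i, ∑ j, |(-A) i j|) + 1, by positivity, 1, PosDef.one, fun x hx => ?_⟩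
  have h1 := dotProduct_mulVec_le (-A) x
  have h2 := real_dotProduct_self_pos hx
  rw [one_mulVec, neg_mulVec, add_mulVec, smul_mulVec, one_mulVec, dotProduct_neg, dotProduct_add,
    dotProduct_smul, smul_eq_mul]
  rw [neg_mulVec, dotProduct_neg] at h1
  linarith

/-- Bass's construction: for large `r` the matrix `-(A + r)` is stable, so that
`(A + r)ᵀ X + X (A + r) = 2 Cᵀ C` has a positive semidefinite solution `X`. Its kernel is invariant
under `A` and contained in the kernel of `C`, so that observability makes `X` positive definite, and
with `K = -X⁻¹ Cᵀ` one has `xᵀ X (A + K C) x = -r xᵀ X x`. -/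
theorem exists_isHurwitz_of_isObservable {A : Matrix (Fin n) (Fin n) ℝ}
    {C : Matrix (Fin p) (Fin n) ℝ} (hAC : IsObservable A C) :
    ∃ K : Matrix (Fin n) (Fin p) ℝ, IsHurwitz (A + K * C) := by
  obtain ⟨r, hr, hM⟩ := exists_isLyapunovStable_neg A
  obtain ⟨X, hXs, hX0, hX⟩ := hM.exists_lyapunov (S := (2 : ℝ) • (Cᵀ * C)) (by simp) fun x => by
    rw [smul_mulVec, dotProduct_smul, ← mulVec_mulVec, ← mulVec_dotProduct, smul_eq_mul]
    exact mul_nonneg zero_le_two (real_dotProduct_self_nonneg _)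
  have hq (x : Fin n → ℝ) : x ⬝ᵥ X *ᵥ (A *ᵥ x) + r * (x ⬝ᵥ X *ᵥ x) = (C *ᵥ x) ⬝ᵥ (C *ᵥ x) := by
    have h1 := dotProduct_lyapunov hXs (-(A + r • (1 : Matrix (Fin n) (Fin n) ℝ))) x
    rw [hX, neg_mulVec, dotProduct_neg, smul_mulVec, dotProduct_smul, ← mulVec_mulVec,
      ← mulVec_dotProduct, smul_eq_mul, neg_mulVec, mulVec_neg, dotProduct_neg, add_mulVec,
      smul_mulVec, one_mulVec, mulVec_add, mulVec_smul, dotProduct_add, dotProduct_smul,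
      smul_eq_mul] at h1
    linarith
  have hker (x : Fin n → ℝ) (hx : X *ᵥ x = 0) : C *ᵥ x = 0 ∧ X *ᵥ (A *ᵥ x) = 0 := by
    have hC : C *ᵥ x = 0 := by
      have h1 := hq x
      rw [dotProduct_mulVec_comm hXs, hx, dotProduct_zero, dotProduct_zero, mul_zero, add_zero]
        at h1
      exact dotProduct_self_eq_zero.1 h1.symm
    refine ⟨hC, ?_⟩
    have h1 := congrArg (· *ᵥ x) hX
    simpa [add_mulVec, ← mulVec_mulVec, hx, neg_mulVec, mulVec_neg, mulVec_add, smul_mulVec,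
      mulVec_smul, hC] using h1
  -- The kernel of `X` is invariant under `A`.
  have hpow (x : Fin n → ℝ) (hx : X *ᵥ x = 0) (k : ℕ) : X *ᵥ (A ^ k *ᵥ x) = 0 := by
    induction k with
    | zero => simpa using hx
    | succ k ih => rw [pow_succ', ← mulVec_mulVec]; exact (hker _ ih).2
  have hXpos : X.PosDef := posDef_iff_real.2 ⟨hXs, fun x hx => lt_of_le_of_ne (hX0 x) fun h => hx <|
    hAC x fun k _ => by
      rw [← mulVec_mulVec]
      exact (hker _ (hpow x (mulVec_eq_zero_of_dotProduct hXs hX0 h.symm) k)).1⟩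
  refine ⟨-(X⁻¹ * Cᵀ), IsLyapunovStable.isHurwitz ⟨X, hXpos, fun x hx => ?_⟩⟩
  have hu : IsUnit X.det := (isUnit_iff_isUnit_det _).1 hXpos.isUnit
  rw [add_mulVec, mulVec_add, Matrix.neg_mul, neg_mulVec, mulVec_neg, mulVec_mulVec x,
    mulVec_mulVec x, ← Matrix.mul_assoc, ← Matrix.mul_assoc, mul_nonsing_inv _ hu, Matrix.one_mul, dotProduct_add,
    dotProduct_neg, ← mulVec_mulVec, ← mulVec_mulVec, ← mulVec_dotProduct, ← hq]
  nlinarith [(posDef_iff_real.1 hXpos).2 x hx]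

end Observer

/-! ### The low-gain Riccati equation -/

section Riccati

variable {n m : ℕ} {A : Matrix (Fin n) (Fin n) ℝ} {B : Matrix (Fin n) (Fin m) ℝ}

theorem dotProduct_input {P : Matrix (Fin n) (Fin n) ℝ} (hP : Pᵀ = P)
    (B : Matrix (Fin n) (Fin m) ℝ) (x : Fin n → ℝ)
    (v : Fin m → ℝ) : x ⬝ᵥ P *ᵥ (B *ᵥ v) = v ⬝ᵥ Bᵀ *ᵥ (P *ᵥ x) := by
  rw [dotProduct_mulVec_comm hP, mulVec_dotProduct]

/-- The Riccati equation as an identity of quadratic forms. -/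
theorem riccati_iff_dotProduct {P : Matrix (Fin n) (Fin n) ℝ} (hP : Pᵀ = P) {δ : ℝ} :
    Aᵀ * P + P * A - P * B * Bᵀ * P + δ • (1 : Matrix (Fin n) (Fin n) ℝ) = 0 ↔
      ∀ x, 2 * (x ⬝ᵥ P *ᵥ (A *ᵥ x)) - (Bᵀ *ᵥ (P *ᵥ x)) ⬝ᵥ (Bᵀ *ᵥ (P *ᵥ x)) + δ * (x ⬝ᵥ x) = 0 := by
  have key (x : Fin n → ℝ) :
      x ⬝ᵥ (Aᵀ * P + P * A - P * B * Bᵀ * P + δ • (1 : Matrix (Fin n) (Fin n) ℝ)) *ᵥ x =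
      2 * (x ⬝ᵥ P *ᵥ (A *ᵥ x)) - (Bᵀ *ᵥ (P *ᵥ x)) ⬝ᵥ (Bᵀ *ᵥ (P *ᵥ x)) + δ * (x ⬝ᵥ x) := by
    rw [add_mulVec, sub_mulVec, dotProduct_add, dotProduct_sub, dotProduct_lyapunov hP,
      ← mulVec_mulVec, ← mulVec_mulVec, ← mulVec_mulVec, dotProduct_input hP B, smul_mulVec,
      one_mulVec, dotProduct_smul, smul_eq_mul]
  constructor
  · intro h x
    rw [← key, h, zero_mulVec, dotProduct_zero]
  · intro h
    refine eq_of_forall_dotProduct ?_ transpose_zero fun x => ?_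
    · simp [transpose_add, transpose_mul, hP, Matrix.mul_assoc, add_comm]
    · rw [key, h, zero_mulVec, dotProduct_zero]

theorem isLowGainRiccatiSolution_iff {P : Matrix (Fin n) (Fin n) ℝ} {δ : ℝ} :
    IsLowGainRiccatiSolution A B δ P ↔ Pᵀ = P ∧ (∀ x, x ≠ 0 → 0 < x ⬝ᵥ P *ᵥ x) ∧
      ∀ x, 2 * (x ⬝ᵥ P *ᵥ (A *ᵥ x)) - (Bᵀ *ᵥ (P *ᵥ x)) ⬝ᵥ (Bᵀ *ᵥ (P *ᵥ x)) + δ * (x ⬝ᵥ x) = 0 := by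
  rw [IsLowGainRiccatiSolution, posDef_iff_real, and_assoc]
  exact and_congr_right fun hP => and_congr_right fun _ => riccati_iff_dotProduct hP

/-- The closed loop of a positive definite solution of the Riccati equation is stable. -/
theorem IsLowGainRiccatiSolution.isLyapunovStable {P : Matrix (Fin n) (Fin n) ℝ} {δ : ℝ}
    (hδ : 0 < δ) (h : IsLowGainRiccatiSolution A B δ P) :
    IsLyapunovStable (A - B * Bᵀ * P) := by
  obtain ⟨hP, -, hr⟩ := isLowGainRiccatiSolution_iff.1 h
  refine ⟨P, h.1, fun x hx => ?_⟩
  rw [sub_mulVec, mulVec_sub, dotProduct_sub, ← mulVec_mulVec, ← mulVec_mulVec,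
    dotProduct_input hP B]
  nlinarith [hr x, real_dotProduct_self_pos hx, real_dotProduct_self_nonneg (Bᵀ *ᵥ (P *ᵥ x))]

/-- The difference of two solutions solves a homogeneous Sylvester equation for the two stable
closed loops. -/
theorem IsLowGainRiccatiSolution.unique {P₁ P₂ : Matrix (Fin n) (Fin n) ℝ} {δ : ℝ} (hδ : 0 < δ)
    (h₁ : IsLowGainRiccatiSolution A B δ P₁) (h₂ : IsLowGainRiccatiSolution A B δ P₂) :
    P₁ = P₂ := by
  have hs : P₁ᵀ = P₁ := (isLowGainRiccatiSolution_iff.1 h₁).1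
  refine sub_eq_zero.1 ((h₁.isLyapunovStable hδ).eq_zero_of_sylvester (h₂.isLyapunovStable hδ) ?_)
  have e₁ := h₁.2
  have e₂ := h₂.2
  rw [transpose_sub, transpose_mul, transpose_mul, transpose_transpose, hs]
  rw [Matrix.mul_assoc P₁ B] at e₁
  rw [Matrix.mul_assoc P₂ B] at e₂
  linear_combination (norm := noncomm_ring) e₁ - e₂

/-- The solution of the Riccati equation is monotone in `δ`: along the closed loop of the larger
parameter the form of the difference `P₂ - P₁` decreases. -/
theorem IsLowGainRiccatiSolution.dotProduct_le {P₁ P₂ : Matrix (Fin n) (Fin n) ℝ} {δ₁ δ₂ : ℝ}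
    (hδ : 0 < δ₂) (hle : δ₁ ≤ δ₂) (h₁ : IsLowGainRiccatiSolution A B δ₁ P₁)
    (h₂ : IsLowGainRiccatiSolution A B δ₂ P₂) (x : Fin n → ℝ) :
    x ⬝ᵥ P₁ *ᵥ x ≤ x ⬝ᵥ P₂ *ᵥ x := by
  obtain ⟨hs₁, -, hr₁⟩ := isLowGainRiccatiSolution_iff.1 h₁
  obtain ⟨hs₂, -, hr₂⟩ := isLowGainRiccatiSolution_iff.1 h₂
  have := (h₂.isLyapunovStable hδ).dotProduct_nonneg (X := P₂ - P₁)
    (by rw [transpose_sub, hs₁, hs₂]) (fun x => ?_) x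
  · rw [sub_mulVec, dotProduct_sub] at this
    linarith
  · rw [sub_mulVec A, ← mulVec_mulVec, ← mulVec_mulVec, sub_mulVec, mulVec_sub, mulVec_sub,
      dotProduct_sub, dotProduct_sub, dotProduct_sub, dotProduct_input hs₁ B,
      dotProduct_input hs₂ B]
    have h3 := real_dotProduct_self_nonneg (Bᵀ *ᵥ (P₂ *ᵥ x) - Bᵀ *ᵥ (P₁ *ᵥ x))
    rw [sub_dotProduct, dotProduct_sub, dotProduct_sub] at h3
    rw [dotProduct_comm (Bᵀ *ᵥ (P₂ *ᵥ x)) (Bᵀ *ᵥ (P₁ *ᵥ x))] at *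
    nlinarith [hr₁ x, hr₂ x, mul_nonneg (sub_nonneg.2 hle) (real_dotProduct_self_nonneg x)]

/-- A decreasing sequence of positive semidefinite matrices converges. -/
theorem exists_tendsto_of_antitone {ι : Type*} [Fintype ι] {P : ℕ → Matrix ι ι ℝ}
    (hs : ∀ k, (P k)ᵀ = P k) (h0 : ∀ k x, 0 ≤ x ⬝ᵥ P k *ᵥ x)
    (hle : ∀ k x, x ⬝ᵥ P (k + 1) *ᵥ x ≤ x ⬝ᵥ P k *ᵥ x) :
    ∃ X, Xᵀ = X ∧ (∀ x, 0 ≤ x ⬝ᵥ X *ᵥ x) ∧ Tendsto P atTop (𝓝 X) := by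
  classical
  have hlim (x : ι → ℝ) : ∃ l, Tendsto (fun k => x ⬝ᵥ P k *ᵥ x) atTop (𝓝 l) :=
    ⟨_, tendsto_atTop_ciInf (antitone_nat_of_succ_le fun k => hle k x)
      ⟨0, by rintro _ ⟨k, rfl⟩; exact h0 k x⟩⟩
  choose l hl using hlim
  -- By polarization the convergence of the forms gives that of the entries.
  have hP : ∃ X, Tendsto P atTop (𝓝 X) := by
    refine ⟨fun i j => (l (Pi.single i 1 + Pi.single j 1) - l (Pi.single i 1 - Pi.single j 1)) / 4,
      tendsto_pi_nhds.2 fun i => tendsto_pi_nhds.2 fun j => ?_⟩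
    simp_rw [fun k => apply_eq_polarization (hs k) i j]
    exact ((hl _).sub (hl _)).div_const 4
  obtain ⟨X, hX⟩ := hP
  refine ⟨X, ?_, fun x => ?_, hX⟩
  · exact tendsto_nhds_unique ((((continuous_id.matrix_transpose).tendsto X).comp hX).congr hs) hX
  · have hc : Continuous fun Y : Matrix ι ι ℝ => x ⬝ᵥ Y *ᵥ x := by
      fun_prop
    exact ge_of_tendsto' ((hc.tendsto X).comp hX) fun k => h0 k x

/-- One step of Kleinman's iteration: the cost matrix `P` of a stabilizing feedback `F`, and the
stability of the closed loop of the improved feedback `-Bᵀ P`. -/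
theorem exists_lyapunov_feedback {F : Matrix (Fin m) (Fin n) ℝ} {δ : ℝ} (hδ : 0 < δ)
    (hF : IsLyapunovStable (A + B * F)) :
    ∃ P : Matrix (Fin n) (Fin n) ℝ, Pᵀ = P ∧ (∀ x, 0 ≤ x ⬝ᵥ P *ᵥ x) ∧
      (∀ x, 2 * (x ⬝ᵥ P *ᵥ (A *ᵥ x)) + 2 * ((F *ᵥ x) ⬝ᵥ Bᵀ *ᵥ (P *ᵥ x)) +
        (F *ᵥ x) ⬝ᵥ (F *ᵥ x) + δ * (x ⬝ᵥ x) = 0) ∧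
      IsLyapunovStable (A + B * -(Bᵀ * P)) := by
  obtain ⟨P, hP, hP0, hr⟩ := hF.exists_lyapunov (S := Fᵀ * F + δ • 1) (by simp) fun x => by
    rw [add_mulVec, dotProduct_add, ← mulVec_mulVec, ← mulVec_dotProduct, smul_mulVec, one_mulVec,
      dotProduct_smul, smul_eq_mul]
    nlinarith [real_dotProduct_self_nonneg x, real_dotProduct_self_nonneg (F *ᵥ x)]
  have hr' (x : Fin n → ℝ) : 2 * (x ⬝ᵥ P *ᵥ (A *ᵥ x)) + 2 * ((F *ᵥ x) ⬝ᵥ Bᵀ *ᵥ (P *ᵥ x)) +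
      (F *ᵥ x) ⬝ᵥ (F *ᵥ x) + δ * (x ⬝ᵥ x) = 0 := by
    have h1 := dotProduct_lyapunov hP (A + B * F) x
    rw [hr, neg_mulVec, dotProduct_neg, add_mulVec, dotProduct_add, ← mulVec_mulVec,
      ← mulVec_dotProduct, smul_mulVec, one_mulVec, dotProduct_smul, smul_eq_mul, add_mulVec,
      mulVec_add, dotProduct_add, ← mulVec_mulVec, dotProduct_input hP B] at h1
    linarith
  have hneg (x : Fin n → ℝ) (hx : x ≠ 0) : x ⬝ᵥ P *ᵥ ((A + B * -(Bᵀ * P)) *ᵥ x) < 0 := by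
    rw [add_mulVec, mulVec_add, dotProduct_add, ← mulVec_mulVec _ B, dotProduct_input hP B,
      neg_mulVec, neg_dotProduct, ← mulVec_mulVec]
    have h2 := real_dotProduct_self_nonneg (F *ᵥ x + Bᵀ *ᵥ (P *ᵥ x))
    rw [add_dotProduct, dotProduct_add, dotProduct_add,
      dotProduct_comm (Bᵀ *ᵥ (P *ᵥ x)) (F *ᵥ x)] at h2
    nlinarith [hr' x, real_dotProduct_self_pos hx, real_dotProduct_self_nonneg (Bᵀ *ᵥ (P *ᵥ x))]
  refine ⟨P, hP, hP0, hr', P, posDef_iff_real.2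
    ⟨hP, fun x hx => lt_of_le_of_ne (hP0 x) fun h => ?_⟩, hneg⟩
  have h1 := hneg x hx
  rw [dotProduct_mulVec_comm hP, mulVec_eq_zero_of_dotProduct hP hP0 h.symm, dotProduct_zero] at h1
  exact lt_irrefl _ h1

/-- Kleinman's iteration started at a stabilizing feedback decreases to a solution of the Riccati
equation. -/
theorem exists_isLowGainRiccatiSolution (hAB : IsStabilizable A B) {δ : ℝ} (hδ : 0 < δ) :
    ∃ P, IsLowGainRiccatiSolution A B δ P := by
  obtain ⟨F₀, hF₀⟩ := hAB
  have hstep (F : {F : Matrix (Fin m) (Fin n) ℝ // IsLyapunovStable (A + B * F)}) :=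
    exists_lyapunov_feedback hδ F.2
  choose P hPs hP0 hPr hPst using hstep
  let F : ℕ → {F : Matrix (Fin m) (Fin n) ℝ // IsLyapunovStable (A + B * F)} :=
    Nat.rec ⟨F₀, hF₀.isLyapunovStable⟩ fun _ F => ⟨-(Bᵀ * P F), hPst F⟩
  have hFs (k) (x) : (F (k + 1)).1 *ᵥ x = -(Bᵀ *ᵥ (P (F k) *ᵥ x)) := by
    change (-(Bᵀ * P (F k))) *ᵥ x = _
    rw [neg_mulVec, mulVec_mulVec]
  have hanti (k) (x) : x ⬝ᵥ P (F (k + 1)) *ᵥ x ≤ x ⬝ᵥ P (F k) *ᵥ x := by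
    have := (F (k + 1)).2.dotProduct_nonneg (X := P (F k) - P (F (k + 1)))
      (by rw [transpose_sub, hPs, hPs]) (fun x => ?_) x
    · rw [sub_mulVec, dotProduct_sub] at this
      linarith
    · have h1 := hPr (F k) x
      have h2 := hPr (F (k + 1)) x
      have h3 := real_dotProduct_self_nonneg ((F k).1 *ᵥ x - (F (k + 1)).1 *ᵥ x)
      rw [sub_mulVec, dotProduct_sub, add_mulVec, mulVec_add, mulVec_add, dotProduct_add,
        dotProduct_add, ← mulVec_mulVec, dotProduct_input (hPs _) B, dotProduct_input (hPs _) B]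
      have h4 : Bᵀ *ᵥ (P (F k) *ᵥ x) = -((F (k + 1)).1 *ᵥ x) := by rw [hFs, neg_neg]
      rw [h4] at h1 ⊢
      rw [sub_dotProduct, dotProduct_sub, dotProduct_sub,
        dotProduct_comm ((F (k + 1)).1 *ᵥ x) ((F k).1 *ᵥ x)] at h3
      rw [dotProduct_neg] at h1 ⊢
      linarith
  obtain ⟨X, hX, hX0, hlim⟩ := exists_tendsto_of_antitone (fun k => hPs (F k))
    (fun k => hP0 (F k)) hanti
  have hr (x : Fin n → ℝ) :
      2 * (x ⬝ᵥ X *ᵥ (A *ᵥ x)) - (Bᵀ *ᵥ (X *ᵥ x)) ⬝ᵥ (Bᵀ *ᵥ (X *ᵥ x)) + δ * (x ⬝ᵥ x) = 0 := by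
    have hc : Continuous fun Y : Matrix (Fin n) (Fin n) ℝ × Matrix (Fin n) (Fin n) ℝ =>
        2 * (x ⬝ᵥ Y.2 *ᵥ (A *ᵥ x)) + 2 * (-(Bᵀ *ᵥ (Y.1 *ᵥ x)) ⬝ᵥ (Bᵀ *ᵥ (Y.2 *ᵥ x))) +
          -(Bᵀ *ᵥ (Y.1 *ᵥ x)) ⬝ᵥ -(Bᵀ *ᵥ (Y.1 *ᵥ x)) + δ * (x ⬝ᵥ x) := by
      fun_prop
    have h1 := (hc.tendsto (X, X)).comp (hlim.prodMk_nhds ((tendsto_add_atTop_iff_nat 1).2 hlim))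
    have h2 := tendsto_nhds_unique (h1.congr fun k => by
      simp only [Function.comp_apply]
      rw [← hFs]
      exact hPr (F (k + 1)) x) tendsto_const_nhds
    simp only [neg_dotProduct, dotProduct_neg, neg_neg] at h2
    linarith
  refine ⟨X, isLowGainRiccatiSolution_iff.2
    ⟨hX, fun x hx => lt_of_le_of_ne (hX0 x) fun h => ?_, hr⟩⟩
  have h0 := mulVec_eq_zero_of_dotProduct hX hX0 h.symm
  have h1 := hr x
  rw [dotProduct_mulVec_comm hX, h0] at h1
  simp only [dotProduct_zero, mulVec_zero, mul_zero, sub_zero, zero_add] at h1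
  nlinarith [real_dotProduct_self_pos hx]

/-- For `δ = 0` the Riccati equation has no nonzero positive semidefinite solution when the
eigenvalues of `A` lie in the closed left half plane and `(A, B)` is stabilizable. -/
theorem eq_zero_of_riccati_zero (hA : EigenvaluesInClosedLeftHalfPlane A)
    (hAB : IsStabilizable A B) {P : Matrix (Fin n) (Fin n) ℝ} (hP : Pᵀ = P)
    (hP0 : ∀ x, 0 ≤ x ⬝ᵥ P *ᵥ x)
    (hr : ∀ x, 2 * (x ⬝ᵥ P *ᵥ (A *ᵥ x)) = (Bᵀ *ᵥ (P *ᵥ x)) ⬝ᵥ (Bᵀ *ᵥ (P *ᵥ x))) : P = 0 := by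
  by_contra hne
  -- The range of `P` is invariant under `Aᵀ`.
  have hinv : Aᵀ * P = P * (B * Bᵀ * P - A) := by
    have := (riccati_iff_dotProduct (A := A) (B := B) hP (δ := 0)).2 fun x => by
      rw [hr]; simp
    rw [Matrix.mul_assoc P B] at this
    linear_combination (norm := noncomm_ring) this
    simp
  let φ := algebraMap ℝ ℂ
  have hinv' : Aᵀ.map φ * P.map φ = P.map φ * (B * Bᵀ * P - A).map φ := by
    rw [← Matrix.map_mul, ← Matrix.map_mul, hinv]
  let W := LinearMap.range (P.map φ).mulVecLin
  have hW : ∀ z ∈ W, (Aᵀ.map φ).mulVecLin z ∈ W := by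
    rintro _ ⟨y, rfl⟩
    refine ⟨(B * Bᵀ * P - A).map φ *ᵥ y, ?_⟩
    simp only [mulVecLin_apply, mulVec_mulVec, hinv']
  have : Nontrivial W := by
    rw [Submodule.nontrivial_iff_ne_bot]
    intro h
    rw [LinearMap.range_eq_bot] at h
    refine hne (Matrix.ext fun i j => ?_)
    have := congrFun (LinearMap.congr_fun h (Pi.single j 1)) i
    simpa [φ] using this
  obtain ⟨μ, hμ⟩ := Module.End.exists_eigenvalue ((Aᵀ.map φ).mulVecLin.restrict hW)
  obtain ⟨⟨z, y, hy⟩, hz, hz0⟩ := hμ.exists_hasEigenvector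
  rw [Module.End.mem_eigenspace_iff] at hz
  have hz := congrArg Subtype.val hz
  simp only [LinearMap.restrict_apply, Submodule.coe_smul] at hz
  have hz0 : z ≠ 0 := fun h => hz0 (Subtype.ext h)
  rw [mulVecLin_apply, map_mulVec_eq_smul_iff] at hz
  let a : Fin n → ℝ := fun i => (y i).re
  let b : Fin n → ℝ := fun i => (y i).im
  have hu : (fun i => (z i).re) = P *ᵥ a := by
    ext i; rw [← hy]; simp [φ, mulVec, dotProduct, a]
  have hv : (fun i => (z i).im) = P *ᵥ b := by
    ext i; rw [← hy]; simp [φ, mulVec, dotProduct, b]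
  rw [hu, hv] at hz
  obtain ⟨h1, h2⟩ := hz
  have huv : P *ᵥ a ≠ 0 ∨ P *ᵥ b ≠ 0 := by
    by_contra! h0
    rw [← hu, ← hv] at h0
    exact hz0 (funext fun i => Complex.ext (congrFun h0.1 i) (congrFun h0.2 i))
  have hre : μ.re ≤ 0 :=
    hA μ (mem_spectrum_transpose_iff.1 (mem_spectrum_iff_exists.2 ⟨_, _, huv, h1, h2⟩))
  have hpos : 0 < a ⬝ᵥ P *ᵥ a + b ⬝ᵥ P *ᵥ b := by
    by_contra! h
    rcases huv with h' | h'
    · exact h' (mulVec_eq_zero_of_dotProduct hP hP0 (le_antisymm (by linarith [hP0 b]) (hP0 a)))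
    · exact h' (mulVec_eq_zero_of_dotProduct hP hP0 (le_antisymm (by linarith [hP0 a]) (hP0 b)))
  -- The Riccati equation tested on the eigenvector: the left side is nonpositive, the right side
  -- nonnegative.
  have hsum : 2 * (μ.re * (a ⬝ᵥ P *ᵥ a + b ⬝ᵥ P *ᵥ b)) =
      (Bᵀ *ᵥ (P *ᵥ a)) ⬝ᵥ (Bᵀ *ᵥ (P *ᵥ a)) + (Bᵀ *ᵥ (P *ᵥ b)) ⬝ᵥ (Bᵀ *ᵥ (P *ᵥ b)) := by
    rw [← hr, ← hr, dotProduct_mulVec_comm hP a (A *ᵥ a),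
      dotProduct_mulVec_comm hP b (A *ᵥ b), mulVec_dotProduct,
      mulVec_dotProduct, h1, h2]
    simp only [dotProduct_sub, dotProduct_add, dotProduct_smul, smul_eq_mul,
      dotProduct_mulVec_comm hP b a]
    ring
  have hBa := real_dotProduct_self_nonneg (Bᵀ *ᵥ (P *ᵥ a))
  have hBb := real_dotProduct_self_nonneg (Bᵀ *ᵥ (P *ᵥ b))
  have hBa0 : Bᵀ *ᵥ (P *ᵥ a) = 0 := dotProduct_self_eq_zero.1 (by nlinarith)
  have hBb0 : Bᵀ *ᵥ (P *ᵥ b) = 0 := dotProduct_self_eq_zero.1 (by nlinarith)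
  obtain ⟨F, hF⟩ := hAB
  have hT (x : Fin n → ℝ) : (A + B * F)ᵀ *ᵥ x = Aᵀ *ᵥ x + Fᵀ *ᵥ (Bᵀ *ᵥ x) := by
    rw [transpose_add, transpose_mul, add_mulVec, mulVec_mulVec]
  -- The pair is also an eigenvector of `(A + B F)ᵀ`, which has a stable spectrum.
  have hlt : μ.re < 0 := hF μ (mem_spectrum_transpose_iff.1 (mem_spectrum_iff_exists.2
    ⟨_, _, huv, by rw [hT, hBa0, mulVec_zero, add_zero, h1],
      by rw [hT, hBb0, mulVec_zero, add_zero, h2]⟩))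
  nlinarith

/-- Low gain: the solutions of the Riccati equation tend to zero with `δ`. -/
theorem exists_forall_dotProduct_le (hA : EigenvaluesInClosedLeftHalfPlane A)
    (hAB : IsStabilizable A B) {ε : ℝ} (hε : 0 < ε) :
    ∃ δs > 0, ∀ δ ∈ Ioc 0 δs, ∀ P, IsLowGainRiccatiSolution A B δ P →
      ∀ x, x ⬝ᵥ P *ᵥ x ≤ ε * (x ⬝ᵥ x) := by
  have hδ (k : ℕ) : 0 < 1 / ((k : ℝ) + 1) := Nat.one_div_pos_of_nat
  choose P hP using fun k => exists_isLowGainRiccatiSolution hAB (hδ k)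
  have hP' := fun k => isLowGainRiccatiSolution_iff.1 (hP k)
  obtain ⟨X, hX, hX0, hlim⟩ := exists_tendsto_of_antitone (P := P) (fun k => (hP' k).1)
    (fun k x => by
      by_cases hx : x = 0
      · simp [hx]
      · exact ((hP' k).2.1 x hx).le)
    (fun k x => (hP (k + 1)).dotProduct_le (hδ k)
      (by push_cast; apply one_div_le_one_div_of_le <;> linarith [k.cast_nonneg (α := ℝ)]) (hP k) x)
  -- The limit solves the Riccati equation with `δ = 0`.
  have hXz : X = 0 := by
    refine eq_zero_of_riccati_zero hA hAB hX hX0 fun x => ?_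
    have hc : Continuous fun Y : Matrix (Fin n) (Fin n) ℝ =>
        2 * (x ⬝ᵥ Y *ᵥ (A *ᵥ x)) - (Bᵀ *ᵥ (Y *ᵥ x)) ⬝ᵥ (Bᵀ *ᵥ (Y *ᵥ x)) := by
      fun_prop
    have h1 := ((hc.tendsto X).comp hlim).add
      ((tendsto_one_div_add_atTop_nhds_zero_nat (𝕜 := ℝ)).mul_const (x ⬝ᵥ x))
    have h2 := tendsto_nhds_unique (h1.congr fun k => (hP' k).2.2 x) tendsto_const_nhds
    linarith
  have hc : Continuous fun Y : Matrix (Fin n) (Fin n) ℝ => ∑ i, ∑ j, |Y i j| := by fun_prop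
  rw [hXz] at hlim
  obtain ⟨k, hk⟩ := (((hc.tendsto 0).comp hlim).eventually
    (gt_mem_nhds (by simpa using hε : _ < ε))).exists
  refine ⟨_, hδ k, fun δ hδ' Q hQ x => ?_⟩
  refine (hQ.dotProduct_le (hδ k) hδ'.2 (hP k) x).trans ((dotProduct_mulVec_le _ _).trans ?_)
  exact mul_le_mul_of_nonneg_right hk.le (real_dotProduct_self_nonneg x)

end Riccati

/-! ### Stability of the error system of an edge -/

section Coupled

variable {n m : ℕ} {A : Matrix (Fin n) (Fin n) ℝ} {B : Matrix (Fin n) (Fin m) ℝ}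

theorem exists_dotProduct_mulVec_self_le {ι κ : Type*} [Fintype ι] [Fintype κ]
    (M : Matrix κ ι ℝ) : ∃ k > 0, ∀ x, (M *ᵥ x) ⬝ᵥ (M *ᵥ x) ≤ k * (x ⬝ᵥ x) := by
  refine ⟨(∑ i, ∑ j, |(Mᵀ * M) i j|) + 1, by positivity, fun x => ?_⟩
  have h := dotProduct_mulVec_le (Mᵀ * M) x
  rw [← mulVec_mulVec, ← mulVec_dotProduct] at h
  linarith [real_dotProduct_self_nonneg x]

theorem dotProduct_young {ι : Type*} [Fintype ι] (s : ℝ) (x y : ι → ℝ) :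
    2 * s * (x ⬝ᵥ y) ≤ x ⬝ᵥ x + s ^ 2 * (y ⬝ᵥ y) := by
  have h := real_dotProduct_self_nonneg (x - s • y)
  simp only [sub_dotProduct, dotProduct_sub, smul_dotProduct, dotProduct_smul, smul_eq_mul,
    dotProduct_comm y x] at h
  linarith

/-- If the solution `P` of the Riccati equation is small, then the system of the scaled
synchronization error `e` of an agent and of its observer error `w = e - χ` is stable, uniformly in
the relative weight `ρ ∈ [1, R]` of its edge. -/
theorem exists_isLyapunovStable_fromBlocks {Ac : Matrix (Fin n) (Fin n) ℝ}
    (B : Matrix (Fin n) (Fin m) ℝ) (hAc : IsLyapunovStable Ac) {R : ℝ} (hR : 0 < R) :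
    ∃ ε > 0, ∀ δ > 0, ∀ P, IsLowGainRiccatiSolution A B δ P →
      (∀ x, x ⬝ᵥ P *ᵥ x ≤ ε * (x ⬝ᵥ x)) → ∀ ρ ∈ Icc 1 R,
        IsLyapunovStable (fromBlocks (A - ρ • (B * Bᵀ * P)) (ρ • (B * Bᵀ * P))
          (-(ρ • (B * Bᵀ * P))) (Ac + ρ • (B * Bᵀ * P))) := by
  obtain ⟨Q, hQ, hneg⟩ := hAc
  obtain ⟨hQs, hQp⟩ := posDef_iff_real.1 hQ
  obtain ⟨b, hb, hbQ⟩ := exists_pos_mul_le_dotProduct (S := -(Q * Ac)) fun x hx => by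
    rw [neg_mulVec, dotProduct_neg, ← mulVec_mulVec]
    linarith [hneg x hx]
  obtain ⟨k, hk, hkQ⟩ := exists_dotProduct_mulVec_self_le (Bᵀ * Q)
  obtain ⟨l, hl, hlB⟩ := exists_dotProduct_mulVec_self_le B
  -- The weight `c` of the observer part is chosen first, so that its coupling with `p = Bᵀ P e`
  -- is dominated by the decay of `Q` and by `-ρ |p|²`; the bound `ε` on `P` then depends on `c`.
  let c := b / (10 * R * k)
  have hc : 0 < c := by positivity
  have hcb : 10 * R * k * c = b := by simp only [c]; field_simp
  refine ⟨min (c * b / (10 * R)) (1 / l), by positivity, ?_⟩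
  intro δ hδ P hP hsmall ρ hρ
  obtain ⟨hPs, hPp, hr⟩ := isLowGainRiccatiSolution_iff.1 hP
  set ε := min (c * b / (10 * R)) (1 / l) with hε
  have hε0 : 0 < ε := by positivity
  have hε1 : 10 * R * ε ≤ c * b := by
    have : ε ≤ c * b / (10 * R) := min_le_left _ _
    rw [le_div_iff₀ (by positivity)] at this
    linarith
  have hε2 : ε * l ≤ 1 := by
    have : ε ≤ 1 / l := min_le_right _ _
    rwa [le_div_iff₀ hl] at this
  have hP0 (x) : 0 ≤ x ⬝ᵥ P *ᵥ x := by
    by_cases hx : x = 0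
    · simp [hx]
    · exact (hPp x hx).le
  -- Smallness of the form `P` bounds `Bᵀ P w`: test `P` on `w` and `B Bᵀ P w`.
  have hq (w : Fin n → ℝ) : (Bᵀ *ᵥ (P *ᵥ w)) ⬝ᵥ (Bᵀ *ᵥ (P *ᵥ w)) ≤ ε * (w ⬝ᵥ w) := by
    have h1 := two_mul_dotProduct_le hPs hP0 w (B *ᵥ (Bᵀ *ᵥ (P *ᵥ w)))
    rw [dotProduct_input hPs] at h1
    have h2 := hsmall (B *ᵥ (Bᵀ *ᵥ (P *ᵥ w)))
    have h3 := mul_le_mul_of_nonneg_left (hlB (Bᵀ *ᵥ (P *ᵥ w))) hε0.le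
    have h4 := mul_le_mul_of_nonneg_right hε2 (real_dotProduct_self_nonneg (Bᵀ *ᵥ (P *ᵥ w)))
    linarith [hsmall w]
  refine ⟨fromBlocks P 0 0 (c • Q), posDef_iff_real.2 ⟨?_, fun z hz => ?_⟩, fun z hz => ?_⟩
  · simp [fromBlocks_transpose, hPs, hQs]
  · rw [← Sum.elim_comp_inl_inr z, fromBlocks_mulVec, sumElim_dotProduct_sumElim]
    simp only [Sum.elim_comp_inl, Sum.elim_comp_inr, zero_mulVec, add_zero, zero_add, smul_mulVec,
      dotProduct_smul, smul_eq_mul]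
    by_cases h1 : z ∘ Sum.inl = 0
    · have h2 : z ∘ Sum.inr ≠ 0 := fun h2 => hz (by
        rw [← Sum.elim_comp_inl_inr z, h1, h2]; ext (i | i) <;> rfl)
      rw [h1, zero_dotProduct, zero_add]
      exact mul_pos hc (hQp _ h2)
    · have h2 : 0 ≤ (z ∘ Sum.inr) ⬝ᵥ Q *ᵥ (z ∘ Sum.inr) := by
        by_cases h : z ∘ Sum.inr = 0
        · simp [h]
        · exact (hQp _ h).le
      exact add_pos_of_pos_of_nonneg (hPp _ h1) (mul_nonneg hc.le h2)
  · rw [← Sum.elim_comp_inl_inr z, fromBlocks_mulVec, fromBlocks_mulVec,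
      sumElim_dotProduct_sumElim]
    simp only [Sum.elim_comp_inl, Sum.elim_comp_inr, zero_mulVec, add_zero, zero_add]
    have hz' : z ∘ Sum.inl ≠ 0 ∨ z ∘ Sum.inr ≠ 0 := by
      by_contra! h
      exact hz (by rw [← Sum.elim_comp_inl_inr z, h.1, h.2]; ext (i | i) <;> rfl)
    generalize z ∘ Sum.inl = e at hz'
    generalize z ∘ Sum.inr = w at hz'
    simp only [add_mulVec, sub_mulVec, neg_mulVec, smul_mulVec, mulVec_add, mulVec_sub, mulVec_neg,
      mulVec_smul, dotProduct_add, dotProduct_sub, dotProduct_neg, dotProduct_smul, smul_eq_mul,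
      ← mulVec_mulVec]
    simp only [dotProduct_input hPs B, dotProduct_input hQs B]
    have hre := hr e
    have hqw := hq w
    have hbw := hbQ w
    have hkw := hkQ w
    rw [neg_mulVec, dotProduct_neg, ← mulVec_mulVec] at hbw
    rw [← mulVec_mulVec] at hkw
    set p := Bᵀ *ᵥ (P *ᵥ e)
    set q := Bᵀ *ᵥ (P *ᵥ w)
    set r := Bᵀ *ᵥ (Q *ᵥ w)
    have y1 := dotProduct_young 4 p q
    have y2 := dotProduct_young (-(4 * c)) p r
    have y3 := dotProduct_young c q r
    have hp0 := real_dotProduct_self_nonneg p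
    have hw0 := real_dotProduct_self_nonneg w
    have he0 := real_dotProduct_self_nonneg e
    have hr0 := real_dotProduct_self_nonneg r
    have hq0 := real_dotProduct_self_nonneg q
    rw [dotProduct_comm q p]
    have hρ0 : 0 < ρ := by linarith [hρ.1]
    -- The three coupling terms, absorbed by `-ρ |p|²` and by the decay of `Q`.
    have hcross : ρ * (p ⬝ᵥ q) - c * (ρ * (p ⬝ᵥ r)) + c * (ρ * (q ⬝ᵥ r)) ≤
        ρ * (p ⬝ᵥ p / 4) + c * b / 2 * (w ⬝ᵥ w) := by
      have s1 : p ⬝ᵥ q - c * (p ⬝ᵥ r) + c * (q ⬝ᵥ r) ≤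
          p ⬝ᵥ p / 4 + 5 / 2 * (q ⬝ᵥ q + c ^ 2 * (r ⬝ᵥ r)) := by
        nlinarith
      have s2 : ρ * (5 / 2 * (q ⬝ᵥ q + c ^ 2 * (r ⬝ᵥ r))) ≤ c * b / 2 * (w ⬝ᵥ w) := by
        have t1 : q ⬝ᵥ q + c ^ 2 * (r ⬝ᵥ r) ≤ (ε + c ^ 2 * k) * (w ⬝ᵥ w) := by
          nlinarith [mul_le_mul_of_nonneg_left hkw (sq_nonneg c)]
        calc ρ * (5 / 2 * (q ⬝ᵥ q + c ^ 2 * (r ⬝ᵥ r)))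
            ≤ R * (5 / 2 * ((ε + c ^ 2 * k) * (w ⬝ᵥ w))) := by
              gcongr; exact hρ.2
          _ = (10 * R * ε + c * (10 * R * k * c)) / 4 * (w ⬝ᵥ w) := by ring
          _ ≤ (c * b + c * b) / 4 * (w ⬝ᵥ w) := by rw [hcb]; gcongr
          _ = c * b / 2 * (w ⬝ᵥ w) := by ring
      nlinarith [mul_le_mul_of_nonneg_left s1 hρ0.le]
    have hcbw : c * (w ⬝ᵥ Q *ᵥ (Ac *ᵥ w)) ≤ -(c * b * (w ⬝ᵥ w)) := by
      nlinarith
    have hstrict : 0 < δ / 2 * (e ⬝ᵥ e) + c * b / 2 * (w ⬝ᵥ w) := by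
      rcases hz' with h | h
      · have := real_dotProduct_self_pos h
        positivity
      · have := real_dotProduct_self_pos h
        positivity
    have hρp : p ⬝ᵥ p ≤ ρ * (p ⬝ᵥ p) := le_mul_of_one_le_left hp0 hρ.1
    linarith

end Coupled

/-! ### Derivatives of joined and shifted curves -/

section Sums

variable {ι κ : Type*}

theorem hasDerivWithinAt_sumElim {x : ℝ → ι → ℝ} {y : ℝ → κ → ℝ} {x' : ι → ℝ} {y' : κ → ℝ}
    {s : Set ℝ} {t : ℝ} (hx : HasDerivWithinAt x x' s t) (hy : HasDerivWithinAt y y' s t) :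
    HasDerivWithinAt (fun t => Sum.elim (x t) (y t)) (Sum.elim x' y') s t := by
  rw [hasDerivWithinAt_pi] at hx hy ⊢
  rintro (i | i)
  exacts [hx i, hy i]

theorem continuousOn_sumElim {x : ℝ → ι → ℝ} {y : ℝ → κ → ℝ} {s : Set ℝ}
    (hx : ContinuousOn x s) (hy : ContinuousOn y s) :
    ContinuousOn (fun t => Sum.elim (x t) (y t)) s := by
  rw [continuousOn_pi] at hx hy ⊢
  rintro (i | i)
  exacts [hx i, hy i]

theorem hasDerivWithinAt_comp_add_const [Fintype ι] {x : ℝ → ι → ℝ} {x' : ι → ℝ} {t s : ℝ}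
    (hx : HasDerivWithinAt x x' (Ici (t + s)) (t + s)) :
    HasDerivWithinAt (fun t => x (t + s)) x' (Ici t) t := by
  have h := HasDerivWithinAt.scomp t hx ((hasDerivWithinAt_id t (Ici t)).add_const s)
    (fun u hu => add_le_add_left (show t ≤ u from hu) s)
  simpa [Function.comp_def] using h

end Sums

/-! ### Trajectories of the network -/

section Network

variable {N n m p q : ℕ} [NeZero N] {A : Matrix (Fin n) (Fin n) ℝ} {B : Matrix (Fin n) (Fin m) ℝ}
  {C : Matrix (Fin p) (Fin n) ℝ} {G : WeightedDigraph N} {τ : Fin N → Fin N → ℝ}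

theorem networkMeasurement_root (hG : G.IsDirectedTree 0) (x : Fin N → ℝ → Fin n → ℝ) (t : ℝ) :
    networkMeasurement C G τ x 0 t = 0 := by
  refine Finset.sum_eq_zero fun j _ => ?_
  rw [le_antisymm (not_lt.1 (hG.1 j)) (G.nonneg 0 j), zero_smul]

theorem weight_eq_zero_of_ne {i j k : Fin N} (hG : G.IsDirectedTree 0) (e : G.IsParent j i)
    (hk : k ≠ j) : G.weight i k = 0 := by
  have hi : i ≠ 0 := by rintro rfl; exact hG.1 _ e
  by_contra h
  exact hk ((hG.2.1 i hi).unique (lt_of_le_of_ne (G.nonneg i k) (Ne.symm h)) e)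

theorem networkMeasurement_of_isParent {i j : Fin N} (hG : G.IsDirectedTree 0)
    (e : G.IsParent j i) (x : Fin N → ℝ → Fin n → ℝ) (t : ℝ) :
    networkMeasurement C G τ x i t = G.weight i j • (C *ᵥ (x i t - x j (t - τ i j))) := by
  rw [networkMeasurement, Finset.sum_eq_single j
    (fun k _ hk => by rw [weight_eq_zero_of_ne hG e hk, zero_smul]) (by simp), mulVec_sub]

theorem laplacian_self_of_isParent {i j : Fin N} (hG : G.IsDirectedTree 0)
    (e : G.IsParent j i) : G.laplacian i i = G.weight i j := by
  rw [WeightedDigraph.laplacian, if_pos rfl, Finset.sum_eq_single j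
    (fun k _ hk => weight_eq_zero_of_ne hG e hk) (by simp)]

/-- The root agent receives no measurement, so its closed loop is the autonomous system with matrix
`(A, B C_c; 0, A_c)`. Uniqueness of its solutions holds also for right derivatives. -/
theorem IsTrajectory.root_eq {D : DynamicProtocol m p q} {x : Fin N → ℝ → Fin n → ℝ}
    {χ : Fin N → ℝ → Fin q → ℝ} (h : IsTrajectory A B C D G τ x χ) (hG : G.IsDirectedTree 0)
    {t : ℝ} (ht : 0 ≤ t) : x 0 t = rootTrajectory A B D (x 0 0) (χ 0 0) t := by
  let M := fromBlocks A (B * D.Cc) 0 D.Ac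
  have heq := ODE_solution_unique (v := fun _ z => M *ᵥ z)
    (f := fun t => Sum.elim (x 0 t) (χ 0 t))
    (g := fun t => NormedSpace.exp (t • M) *ᵥ Sum.elim (x 0 0) (χ 0 0)) (a := 0) (b := t)
    (fun _ => (LinearMap.toContinuousLinearMap M.mulVecLin).lipschitz)
    ((continuousOn_sumElim (h.continuousOn_state 0) (h.continuousOn_protocol 0)).mono
      Icc_subset_Ici_self)
    (fun s hs => by
      have := hasDerivWithinAt_sumElim (h.state_eq 0 s hs.1) (h.protocol_eq 0 s hs.1)
      rw [networkMeasurement_root hG] at this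
      simpa [M, fromBlocks_mulVec, mulVec_mulVec] using this)
    (fun s _ => (hasDerivAt_exp_mulVec _ _ s).continuousAt.continuousWithinAt)
    (fun s _ => (hasDerivAt_exp_mulVec _ _ s).hasDerivWithinAt)
    (by simp)
  have := heq (right_mem_Icc.2 ht)
  exact funext fun k => congrFun this (Sum.inl k)

theorem rootTrajectory_zero (D : DynamicProtocol m p q) (x₀ : Fin n → ℝ) (t : ℝ) :
    rootTrajectory A B D x₀ 0 t = NormedSpace.exp (t • A) *ᵥ x₀ := by
  let M := fromBlocks A (B * D.Cc) 0 D.Ac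
  have heq := ODE_solution_unique_univ (v := fun _ z => M *ᵥ z) (s := fun _ => univ)
    (f := fun t => NormedSpace.exp (t • M) *ᵥ Sum.elim x₀ 0)
    (g := fun t => Sum.elim (NormedSpace.exp (t • A) *ᵥ x₀) 0) (t₀ := 0)
    (fun _ => (LinearMap.toContinuousLinearMap M.mulVecLin).lipschitz.lipschitzOnWith)
    (fun s => ⟨hasDerivAt_exp_mulVec _ _ s, mem_univ _⟩)
    (fun s => ⟨by
      have := hasDerivWithinAt_sumElim (hasDerivAt_exp_mulVec A x₀ s).hasDerivWithinAt
        (hasDerivWithinAt_const s univ (0 : Fin q → ℝ))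
      rw [hasDerivWithinAt_univ] at this
      simpa [M, fromBlocks_mulVec] using this, mem_univ _⟩)
    (by simp)
  exact funext fun k => congrFun (congrFun heq t) (Sum.inl k)

/-- Induction along the path from the root: the protocol state of each agent tends to zero, and its
delay-shifted state approaches that of the root. -/
theorem IsTrajectory.tendsto_of_pathDelay {K : Matrix (Fin n) (Fin p) ℝ}
    {P : Matrix (Fin n) (Fin n) ℝ} {α β : ℝ} (hβ : 0 < β) (hAc : IsLyapunovStable (A + K * C))
    (hst : ∀ ρ ∈ Icc 1 (α / β), IsLyapunovStable (fromBlocks (A - ρ • (B * Bᵀ * P))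
      (ρ • (B * Bᵀ * P)) (-(ρ • (B * Bᵀ * P))) (A + K * C + ρ • (B * Bᵀ * P))))
    (hG : G ∈ spanningTreeGraphs N α β) (hτ : ∀ i j, 0 ≤ τ i j) {x χ : Fin N → ℝ → Fin n → ℝ}
    (h : IsTrajectory A B C (observerProtocol A B C K β P) G τ x χ) {i : Fin N} {d : ℝ}
    (hd : G.PathDelay τ 0 i d) :
    0 ≤ d ∧ Tendsto (χ i) atTop (𝓝 0) ∧ Tendsto (fun t => x i (t + d) - x 0 t) atTop (𝓝 0) := by
  obtain ⟨htree, -, -, hdiag⟩ := hG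
  induction hd with
  | root =>
    refine ⟨le_rfl, ?_, by simp⟩
    refine hAc.tendsto_zero (f := fun _ => 0) (h.continuousOn_protocol 0) (fun t ht => ?_)
      tendsto_const_nhds
    have := h.protocol_eq 0 t ht
    rw [networkMeasurement_root htree] at this
    simpa [observerProtocol] using this
  | @step i j d hj e ih =>
    obtain ⟨hd0, hχj, hxj⟩ := ih
    have hi : i ≠ 0 := by rintro rfl; exact htree.1 _ e
    set a := G.weight i j with ha
    have ha0 : 0 < a := e
    have hρ : a / β ∈ Icc 1 (α / β) := by
      have := hdiag i hi
      rw [laplacian_self_of_isParent htree e] at this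
      exact ⟨(one_le_div hβ).2 this.1, div_le_div_of_nonneg_right this.2 hβ.le⟩
    set s := d + τ i j with hs
    have hs0 : 0 ≤ s := add_nonneg hd0 (hτ i j)
    -- In shifted time the measurement of agent `i` is `C ε`, without delay.
    let ε : ℝ → Fin n → ℝ := fun t => a • (x i (t + s) - x j (t + d))
    let f : ℝ → Fin n → ℝ := fun t => (a / β) • (B *ᵥ (Bᵀ *ᵥ (P *ᵥ χ j (t + d))))
    have hmeas (t : ℝ) :
        networkMeasurement C G τ x i (t + s) = C *ᵥ ε t := by
      rw [networkMeasurement_of_isParent htree e, mulVec_smul, hs]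
      congr 4
      ring_nf
    have hshift {y : ℝ → Fin n → ℝ} (hy : ContinuousOn y (Ici 0)) {r : ℝ} (hr : 0 ≤ r) :
        ContinuousOn (fun t => y (t + r)) (Ici 0) :=
      hy.comp (by fun_prop) fun t ht => add_nonneg (show 0 ≤ t from ht) hr
    have hεc : ContinuousOn ε (Ici 0) :=
      ((hshift (h.continuousOn_state i) hs0).sub (hshift (h.continuousOn_state j) hd0)).const_smul a
    have hεd (t : ℝ) (ht : 0 ≤ t) : HasDerivWithinAt ε
        (A *ᵥ ε t - (a / β) • (B *ᵥ (Bᵀ *ᵥ (P *ᵥ χ i (t + s)))) + f t) (Ici t) t := by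
      have h1 := hasDerivWithinAt_comp_add_const (h.state_eq i (t + s) (add_nonneg ht hs0))
      have h2 := hasDerivWithinAt_comp_add_const (h.state_eq j (t + d) (add_nonneg ht hd0))
      refine ((h1.sub h2).const_smul a).congr_deriv ?_
      simp only [observerProtocol, zero_mulVec, add_zero, neg_mulVec, mulVec_neg, smul_mulVec,
        mulVec_smul, ← mulVec_mulVec, mulVec_sub, ε, f, smul_sub, smul_add, smul_neg, smul_smul,
        div_eq_mul_inv]
      abel
    have hχd (t : ℝ) (ht : 0 ≤ t) : HasDerivWithinAt (fun t => χ i (t + s))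
        ((A + K * C) *ᵥ χ i (t + s) - K *ᵥ (C *ᵥ ε t)) (Ici t) t := by
      have h1 := hasDerivWithinAt_comp_add_const (h.protocol_eq i (t + s) (add_nonneg ht hs0))
      rw [hmeas] at h1
      refine h1.congr_deriv ?_
      simp only [observerProtocol, neg_mulVec, sub_eq_add_neg]
    have hf : Tendsto f atTop (𝓝 0) := by
      have hc : Continuous fun v : Fin n → ℝ => (a / β) • (B *ᵥ (Bᵀ *ᵥ (P *ᵥ v))) := by fun_prop
      have h0 := hc.tendsto 0
      simp only [mulVec_zero, smul_zero] at h0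
      exact h0.comp (hχj.comp (tendsto_atTop_add_const_right _ d tendsto_id))
    -- The parent enters the equations of `ε` and of `ε - χ_i` through the same vanishing term `f`.
    have hz := (hst _ hρ).tendsto_zero (z := fun t => Sum.elim (ε t) (ε t - χ i (t + s)))
      (f := fun t => Sum.elim (f t) (f t))
      (continuousOn_sumElim hεc (hεc.sub (hshift (h.continuousOn_protocol i) hs0)))
      (fun t ht => by
        refine (hasDerivWithinAt_sumElim (hεd t ht) ((hεd t ht).sub (hχd t ht))).congr_deriv ?_
        rw [fromBlocks_mulVec, ← Sum.elim_add_add]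
        simp only [Sum.elim_comp_inl, Sum.elim_comp_inr, add_mulVec, sub_mulVec, neg_mulVec,
          smul_mulVec, mulVec_sub, ← mulVec_mulVec]
        congr 1 <;> abel)
      (by
        rw [tendsto_pi_nhds] at hf ⊢
        rintro (k | k)
        exacts [hf k, hf k])
    rw [tendsto_pi_nhds] at hz
    have hε0 : Tendsto ε atTop (𝓝 0) := tendsto_pi_nhds.2 fun k => hz (Sum.inl k)
    have hw0 : Tendsto (fun t => ε t - χ i (t + s)) atTop (𝓝 0) :=
      tendsto_pi_nhds.2 fun k => hz (Sum.inr k)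
    refine ⟨hs0, ?_, ?_⟩
    · have h1 := hε0.sub hw0
      simp only [sub_sub_cancel, sub_zero] at h1
      have h2 := h1.comp (tendsto_atTop_add_const_right _ (-s) tendsto_id)
      simpa [Function.comp_def] using h2
    · have h1 := (hε0.const_smul a⁻¹).add hxj
      simpa [ε, smul_smul, inv_mul_cancel₀ ha0.ne'] using h1

end Network

end MAS

theorem mainTheorem2 {n m p : ℕ} (N : ℕ) [NeZero N]
    (A : Matrix (Fin n) (Fin n) ℝ) (B : Matrix (Fin n) (Fin m) ℝ) (C : Matrix (Fin p) (Fin n) ℝ)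
    (α β : ℝ) (hβ : 0 < β) (hαβ : β < α)
    (hA : MAS.EigenvaluesInClosedLeftHalfPlane A)
    (hAB : MAS.IsStabilizable A B) (hAC : MAS.IsObservable A C) :
    -- the delayed state synchronization problem is solvable by a dynamic protocol
    (∃ (q : ℕ) (D : MAS.DynamicProtocol m p q),
      MAS.SolvesDelayedStateSynchronization A B C (MAS.spanningTreeGraphs N α β) D) ∧
    -- the design is well defined
    (∃ K : Matrix (Fin n) (Fin p) ℝ, MAS.IsHurwitz (A + K * C)) ∧
    (∀ δ : ℝ, 0 < δ → ∃! P, MAS.IsLowGainRiccatiSolution A B δ P) ∧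
    -- the observer-based low-gain protocol is a solution
    ∀ K : Matrix (Fin n) (Fin p) ℝ, MAS.IsHurwitz (A + K * C) →
      ∃ δs : ℝ, 0 < δs ∧ ∀ δ ∈ Set.Ioc 0 δs, ∀ P, MAS.IsLowGainRiccatiSolution A B δ P →
        MAS.SolvesDelayedStateSynchronization A B C (MAS.spanningTreeGraphs N α β)
          (MAS.observerProtocol A B C K β P) ∧
        -- the synchronized trajectory is that of the root agent
        ∀ G ∈ MAS.spanningTreeGraphs N α β, ∀ τ : Fin N → Fin N → ℝ, (∀ i j, 0 ≤ τ i j) →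
          ∀ x χ, MAS.IsTrajectory A B C (MAS.observerProtocol A B C K β P) G τ x χ →
            (∀ t, 0 ≤ t → x 0 t =
              MAS.rootTrajectory A B (MAS.observerProtocol A B C K β P) (x 0 0) (χ 0 0) t) ∧
            (∀ i d, G.PathDelay τ 0 i d → Filter.Tendsto (fun t => x i (t + d) -
              MAS.rootTrajectory A B (MAS.observerProtocol A B C K β P) (x 0 0) (χ 0 0) t)
              Filter.atTop (nhds 0)) ∧
            (χ 0 0 = 0 → ∀ t,
              MAS.rootTrajectory A B (MAS.observerProtocol A B C K β P) (x 0 0) (χ 0 0) t =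
                NormedSpace.exp (t • A) *ᵥ x 0 0) := by
  obtain ⟨K₀, hK₀⟩ := MAS.exists_isHurwitz_of_isObservable hAC
  have hR : 0 < α / β := div_pos (hβ.trans hαβ) hβ
  have hric (δ : ℝ) (hδ : 0 < δ) : ∃! P, MAS.IsLowGainRiccatiSolution A B δ P := by
    obtain ⟨P, hP⟩ := MAS.exists_isLowGainRiccatiSolution hAB hδ
    exact ⟨P, hP, fun P' hP' => hP'.unique hδ hP⟩
  have hmain (K : Matrix (Fin n) (Fin p) ℝ) (hK : MAS.IsHurwitz (A + K * C)) :
      ∃ δs : ℝ, 0 < δs ∧ ∀ δ ∈ Set.Ioc 0 δs, ∀ P, MAS.IsLowGainRiccatiSolution A B δ P →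
        ∀ G ∈ MAS.spanningTreeGraphs N α β, ∀ τ : Fin N → Fin N → ℝ, (∀ i j, 0 ≤ τ i j) →
          ∀ x χ, MAS.IsTrajectory A B C (MAS.observerProtocol A B C K β P) G τ x χ →
            ∀ i d, G.PathDelay τ 0 i d → Tendsto (fun t => x i (t + d) - x 0 t) atTop (𝓝 0) := by
    obtain ⟨ε, hε, hstab⟩ :=
      MAS.exists_isLyapunovStable_fromBlocks (A := A) B hK.isLyapunovStable hR
    obtain ⟨δs, hδs, hsmall⟩ := MAS.exists_forall_dotProduct_le hA hAB hε
    exact ⟨δs, hδs, fun δ hδ P hP G hG τ hτ x χ hx i d hd =>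
      (hx.tendsto_of_pathDelay hβ hK.isLyapunovStable
        (hstab δ hδ.1 P hP (hsmall δ hδ P hP)) hG hτ hd).2.2⟩
  have hsync (K : Matrix (Fin n) (Fin p) ℝ) (hK : MAS.IsHurwitz (A + K * C)) :
      ∃ δs : ℝ, 0 < δs ∧ ∀ δ ∈ Set.Ioc 0 δs, ∀ P, MAS.IsLowGainRiccatiSolution A B δ P →
        MAS.SolvesDelayedStateSynchronization A B C (MAS.spanningTreeGraphs N α β)
          (MAS.observerProtocol A B C K β P) ∧
        ∀ G ∈ MAS.spanningTreeGraphs N α β, ∀ τ : Fin N → Fin N → ℝ, (∀ i j, 0 ≤ τ i j) →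
          ∀ x χ, MAS.IsTrajectory A B C (MAS.observerProtocol A B C K β P) G τ x χ →
            (∀ t, 0 ≤ t → x 0 t =
              MAS.rootTrajectory A B (MAS.observerProtocol A B C K β P) (x 0 0) (χ 0 0) t) ∧
            (∀ i d, G.PathDelay τ 0 i d → Tendsto (fun t => x i (t + d) -
              MAS.rootTrajectory A B (MAS.observerProtocol A B C K β P) (x 0 0) (χ 0 0) t)
              atTop (𝓝 0)) ∧
            (χ 0 0 = 0 → ∀ t,
              MAS.rootTrajectory A B (MAS.observerProtocol A B C K β P) (x 0 0) (χ 0 0) t =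
                NormedSpace.exp (t • A) *ᵥ x 0 0) := by
    obtain ⟨δs, hδs, h⟩ := hmain K hK
    refine ⟨δs, hδs, fun δ hδ P hP => ⟨fun G hG τ hτ x χ hx i j di dj hi hj => ?_,
      fun G hG τ hτ x χ hx => ⟨fun t ht => hx.root_eq hG.1 ht, fun i d hd => ?_, fun h0 t => ?_⟩⟩⟩
    -- Both agents are compared with the root at time `t - di`.
    · have hshift := tendsto_atTop_add_const_right atTop (-di) (tendsto_id (α := ℝ))
      have hlim := ((h δ hδ P hP G hG τ hτ x χ hx i di hi).comp hshift).sub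
        ((h δ hδ P hP G hG τ hτ x χ hx j dj hj).comp hshift)
      simp only [Function.comp_def, id, neg_add_cancel_right, sub_sub_sub_cancel_right,
        sub_zero] at hlim
      refine hlim.congr fun t => ?_
      rw [sub_sub_eq_add_sub, ← sub_eq_add_neg, sub_add_eq_add_sub]
    · refine (h δ hδ P hP G hG τ hτ x χ hx i d hd).congr' ?_
      filter_upwards [eventually_ge_atTop 0] with t ht
      rw [← hx.root_eq hG.1 ht]
    · rw [h0, MAS.rootTrajectory_zero]
  refine ⟨?_, ⟨K₀, hK₀⟩, hric, hsync⟩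
  obtain ⟨δs, hδs, h⟩ := hsync K₀ hK₀
  obtain ⟨P, hP, -⟩ := hric δs hδs
  exact ⟨n, _, (h δs ⟨hδs, le_rfl⟩ P hP).1⟩
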